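/- Let $p,q$ be coprime positive integers and let $\mathbb K$ be $\mathbb R$ or $\mathbb C$. Consider the systems $$\dot x = px+P(x,y),\qquad \dot y=-qy+Q(x,y),$$ where $P,Q\in\mathbb K[x,y]$ have no constant and no linear terms and $\max(\deg P,\deg Q)=n$. For every such system there is a formal power series $H=x^qy^p+(\text{terms of degree}>p+q)$ whose derivative along the system has the form $\dot H=\sum_{k\ge 1}L_k\,(x^qy^p)^{k+1}$; if not all $L_k$ vanish, the smallest $k$ with $L_k\neq 0$ does not depend on the choice of $H$ and is called the saddle order of the system. Let $M(p,q,n)$ be the maximal saddle order (the supremum of the saddle orders) of such systems of degree $n$ with some $L_k\ne0$. Then there is an $N$ (depending only on $p$, $q$ and $\mathbb K$) such that for all $n\ge N$ $$M(p,q,n)\;\ge\; n^2-2rn+r^2-1,$$ where $r$ is the integer with $0\le r\le p+q-1$ and $r\equiv n \pmod{p+q}$. -/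

import Mathlib

noncomputable section

namespace ResonantSaddle

/-- The exponent of the resonant monomial `x ^ q * y ^ p`; the variables are `x = X 0`, `y = X 1`. -/
def resExp (p q : ℕ) : Fin 2 →₀ ℕ :=
  Finsupp.single 0 q + Finsupp.single 1 p

/-- The formal derivative `dH/dt = (p x + P) ∂H/∂x + (- q y + Q) ∂H/∂y` of a formal power series
`H` along the system `dx/dt = p x + P(x, y)`, `dy/dt = - q y + Q(x, y)`. -/
def lieDeriv {𝕜 : Type*} [Field 𝕜] (p q : ℕ) (P Q : MvPolynomial (Fin 2) 𝕜)
    (H : MvPowerSeries (Fin 2) 𝕜) : MvPowerSeries (Fin 2) 𝕜 :=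
  ((p : MvPowerSeries (Fin 2) 𝕜) * MvPowerSeries.X 0 + (P : MvPowerSeries (Fin 2) 𝕜)) *
      MvPowerSeries.pderiv 𝕜 0 H
  + (-((q : MvPowerSeries (Fin 2) 𝕜) * MvPowerSeries.X 1) + (Q : MvPowerSeries (Fin 2) 𝕜)) *
      MvPowerSeries.pderiv 𝕜 1 H

/-- `F` has no constant and no linear terms. -/
def IsNonlinear {𝕜 : Type*} [Field 𝕜] (F : MvPolynomial (Fin 2) 𝕜) : Prop :=
  ∀ m : Fin 2 →₀ ℕ, m.degree ≤ 1 → F.coeff m = 0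

/-- The values `L 1, L 2, …` are saddle values of the system `dx/dt = p x + P`, `dy/dt = - q y + Q`:
there is a formal power series `H = x ^ q * y ^ p + (terms of degree > p + q)` with
`dH/dt = ∑_{k ≥ 1} L k * (x ^ q * y ^ p) ^ (k + 1)`, compared coefficient by coefficient.
The entry `L 0` is not used. -/
def IsSaddleValues {𝕜 : Type*} [Field 𝕜] (p q : ℕ) (P Q : MvPolynomial (Fin 2) 𝕜)
    (L : ℕ → 𝕜) : Prop :=
  ∃ H : MvPowerSeries (Fin 2) 𝕜,
    (∀ m : Fin 2 →₀ ℕ, m.degree ≤ p + q →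
      MvPowerSeries.coeff m H =
        MvPowerSeries.coeff m (MvPowerSeries.monomial (resExp p q) (1 : 𝕜))) ∧
    (∀ k : ℕ, 1 ≤ k →
      MvPowerSeries.coeff ((k + 1) • resExp p q) (lieDeriv p q P Q H) = L k) ∧
    (∀ m : Fin 2 →₀ ℕ, (∀ k : ℕ, 1 ≤ k → m ≠ (k + 1) • resExp p q) →
      MvPowerSeries.coeff m (lieDeriv p q P Q H) = 0)

/-- The saddle order of the system `dx/dt = p x + P`, `dy/dt = - q y + Q` is `k`: the first nonzero
saddle value is the `k`-th one. (The saddle values depend on the choice of `H`, the saddle order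
does not. An integrable system has no saddle order.) -/
def HasSaddleOrder {𝕜 : Type*} [Field 𝕜] (p q : ℕ) (P Q : MvPolynomial (Fin 2) 𝕜)
    (k : ℕ) : Prop :=
  1 ≤ k ∧ ∃ L : ℕ → 𝕜, IsSaddleValues p q P Q L ∧ L k ≠ 0 ∧ ∀ j : ℕ, 1 ≤ j → j < k → L j = 0

/-- The maximal saddle order `M(p, q, n)` over the field `𝕜`: the supremum in `ℕ∞` of the saddle
orders of the systems `dx/dt = p x + P`, `dy/dt = - q y + Q` of degree `n`, where `P` and `Q` have
no constant and linear terms. -/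
def maxSaddleOrder (𝕜 : Type*) [Field 𝕜] (p q n : ℕ) : ℕ∞ :=
  sSup {s : ℕ∞ | ∃ (P Q : MvPolynomial (Fin 2) 𝕜) (k : ℕ),
    IsNonlinear P ∧ IsNonlinear Q ∧ max P.totalDegree Q.totalDegree = n ∧
    HasSaddleOrder p q P Q k ∧ s = (k : ℕ∞)}

end ResonantSaddle

end

/-!
Put `n = m (p + q)`, `S = q m` and `T = p m`, so that `n = S + T`. It suffices to find a system of
degree `n` whose saddle order is `n ^ 2 - 1`: multiplying it by `(1 + x) ^ r` raises the degree by
`r` and keeps the saddle order (`isNonlinear_and_hasSaddleOrder_of_unit_mul`).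

Start with the integrable system `(1 + g) (p x ∂/∂x - q y ∂/∂y)`, where
`g = x ^ (S - 1) (x + y) ^ T` is a form of degree `n - 1`, and perturb it by a linear combination
`∑ c i V i` of `n + 2` homogeneous fields `V i` of degree `n`. Dividing by the unit `1 + g` gives a
perturbation of the linear saddle in which all terms have degree congruent to one modulo `n - 1`.
As `n - 1` is coprime to `p + q`, the saddle value number `k` vanishes unless `n - 1` divides `k`
(`supportedMod_alongField_normalIntegral`). It remains to make the saddle values number
`(n - 1) j`, `j = 1, …, n`, vanish and the one with `j = n + 1` nonzero; this gives the order
`(n - 1) (n + 1)`.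

The formal first integral is obtained from a fixed point of a contraction (`correction`), so its
coefficients, and with them the saddle values, are `C¹` functions of `c`. Their derivatives at
`c = 0` are first-order Melnikov terms, which are, up to a nonzero factor, the binomial coefficients
`(n A + S + 1 - i).choose ((n - 1) A + 1)` with `A = p j` (`coeff_alongField_pert`). The crucial fact
is that these `n + 1` linear functionals are independent. After removal of a factor that does not
depend on `i`, column `i` is a polynomial `binomPoly` in `A` of degree at most `n + 1` that vanishes
at `A = 0`; a linear combination that vanishes at `A = p, …, (n + 1) p` too is zero, and evaluation
at suitable rational points shows that the coefficients vanish
(`eq_zero_of_sum_mul_choose_eq_zero`). The column `i = S + 2` has to be left out, because the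
`n + 2` columns satisfy one linear relation. Hence `c ↦ (c (S + 2), saddle values)` is open at the origin
(`map_nhds_zero_sum_mul`), and small saddle values can be prescribed.
-/

noncomputable section

namespace ResonantSaddle

open MvPowerSeries Finset

section Formal

variable {𝕜 : Type*} [Field 𝕜]

/-! ### Order of vanishing and grading of formal power series -/

/-- All terms of `F` have degree at least `N`. -/
def VanishesBelow (N : ℕ) (F : MvPowerSeries (Fin 2) 𝕜) : Prop :=
  ∀ m : Fin 2 →₀ ℕ, m.degree < N → coeff m F = 0

namespace VanishesBelow

variable {N M : ℕ} {F G : MvPowerSeries (Fin 2) 𝕜}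

lemma mono (h : VanishesBelow N F) (hM : M ≤ N) : VanishesBelow M F :=
  fun m hm => h m (hm.trans_le hM)

lemma add (hF : VanishesBelow N F) (hG : VanishesBelow N G) : VanishesBelow N (F + G) :=
  fun m hm => by rw [map_add, hF m hm, hG m hm, add_zero]

lemma sum {ι : Type*} (s : Finset ι) {f : ι → MvPowerSeries (Fin 2) 𝕜}
    (h : ∀ i ∈ s, VanishesBelow N (f i)) : VanishesBelow N (∑ i ∈ s, f i) :=
  fun m hm => by rw [map_sum]; exact Finset.sum_eq_zero fun i hi => h i hi m hm

lemma mul (hF : VanishesBelow N F) (hG : VanishesBelow M G) : VanishesBelow (N + M) (F * G) := by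
  classical
  intro m hm
  rw [coeff_mul]
  refine Finset.sum_eq_zero fun x hx => ?_
  rw [HasAntidiagonal.mem_antidiagonal] at hx
  have h : x.1.degree + x.2.degree = m.degree := by rw [← hx, map_add]
  by_cases h1 : x.1.degree < N
  · rw [hF _ h1, zero_mul]
  · rw [hG _ (by omega), mul_zero]

lemma mul_left (G : MvPowerSeries (Fin 2) 𝕜) (hF : VanishesBelow N F) :
    VanishesBelow N (G * F) := by
  have := VanishesBelow.mul (F := G) (N := 0) (fun m hm => by simp at hm) hF
  rwa [zero_add] at this

lemma smul (a : 𝕜) (hF : VanishesBelow N F) : VanishesBelow N (a • F) :=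
  fun m hm => by rw [coeff_smul, hF m hm, mul_zero]

lemma pderiv (i : Fin 2) (hF : VanishesBelow (N + 1) F) :
    VanishesBelow N (MvPowerSeries.pderiv 𝕜 i F) := fun m hm => by
  rw [coeff_pderiv, hF _ (by rw [map_add, Finsupp.degree_single]; omega), zero_mul]

lemma one_of_constantCoeff (h : constantCoeff F = 0) : VanishesBelow 1 F := fun m hm => by
  have : m = 0 := by rw [← Finsupp.degree_eq_zero_iff]; omega
  rw [this, coeff_zero_eq_constantCoeff_apply, h]

end VanishesBelow

/-- All terms of `F` have degree congruent to `a` modulo `D`. -/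
def SupportedMod (D a : ℕ) (F : MvPowerSeries (Fin 2) 𝕜) : Prop :=
  ∀ m : Fin 2 →₀ ℕ, ¬ m.degree ≡ a [MOD D] → coeff m F = 0

namespace SupportedMod

variable {D a b : ℕ} {F G : MvPowerSeries (Fin 2) 𝕜}

lemma add (hF : SupportedMod D a F) (hG : SupportedMod D a G) : SupportedMod D a (F + G) :=
  fun m hm => by rw [map_add, hF m hm, hG m hm, add_zero]

lemma sum {ι : Type*} (s : Finset ι) {f : ι → MvPowerSeries (Fin 2) 𝕜}
    (h : ∀ i ∈ s, SupportedMod D a (f i)) : SupportedMod D a (∑ i ∈ s, f i) :=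
  fun m hm => by rw [map_sum]; exact Finset.sum_eq_zero fun i hi => h i hi m hm

lemma smul (c : 𝕜) (hF : SupportedMod D a F) : SupportedMod D a (c • F) :=
  fun m hm => by rw [coeff_smul, hF m hm, mul_zero]

lemma mul (hF : SupportedMod D a F) (hG : SupportedMod D b G) :
    SupportedMod D (a + b) (F * G) := by
  classical
  intro m hm
  rw [coeff_mul]
  refine Finset.sum_eq_zero fun x hx => ?_
  rw [HasAntidiagonal.mem_antidiagonal] at hx
  have h : x.1.degree + x.2.degree = m.degree := by rw [← hx, map_add]
  by_cases h1 : x.1.degree ≡ a [MOD D]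
  · rw [hG, mul_zero]
    intro h2
    exact hm (h ▸ h1.add h2)
  · rw [hF _ h1, zero_mul]

lemma pderiv (i : Fin 2) (hF : SupportedMod D (a + 1) F) :
    SupportedMod D a (MvPowerSeries.pderiv 𝕜 i F) := fun m hm => by
  rw [coeff_pderiv, hF, zero_mul]
  rw [map_add, Finsupp.degree_single]
  exact fun h => hm (Nat.ModEq.add_right_cancel' 1 h)

end SupportedMod

/-! ### Derivatives along formal vector fields -/

/-- The derivative of `H` along the formal vector field `A ∂/∂x + B ∂/∂y`. -/
def alongField (A B H : MvPowerSeries (Fin 2) 𝕜) : MvPowerSeries (Fin 2) 𝕜 :=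
  A * pderiv 𝕜 0 H + B * pderiv 𝕜 1 H

/-- The derivative of `H` along the linear field `p x ∂/∂x - q y ∂/∂y`. -/
def alongLinear (p q : ℕ) (H : MvPowerSeries (Fin 2) 𝕜) : MvPowerSeries (Fin 2) 𝕜 :=
  alongField ((p : MvPowerSeries (Fin 2) 𝕜) * X 0) (-((q : MvPowerSeries (Fin 2) 𝕜) * X 1)) H

lemma alongField_add (A B H K : MvPowerSeries (Fin 2) 𝕜) :
    alongField A B (H + K) = alongField A B H + alongField A B K := by
  simp only [alongField, map_add]; ring

lemma alongField_sub (A B H K : MvPowerSeries (Fin 2) 𝕜) :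
    alongField A B (H - K) = alongField A B H - alongField A B K := by
  simp only [alongField, map_sub]; ring

lemma alongLinear_add (p q : ℕ) (H K : MvPowerSeries (Fin 2) 𝕜) :
    alongLinear p q (H + K) = alongLinear p q H + alongLinear p q K :=
  alongField_add _ _ _ _

lemma lieDeriv_eq (p q : ℕ) (P Q : MvPolynomial (Fin 2) 𝕜) (H : MvPowerSeries (Fin 2) 𝕜) :
    lieDeriv p q P Q H = alongLinear p q H + alongField P Q H := by
  simp only [lieDeriv, alongLinear, alongField]; ring

lemma coeff_X_mul_pderiv (i : Fin 2) (H : MvPowerSeries (Fin 2) 𝕜) (m : Fin 2 →₀ ℕ) :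
    coeff m (X i * pderiv 𝕜 i H) = (m i : 𝕜) * coeff m H := by
  classical
  by_cases h : m i = 0
  · rw [X, coeff_monomial_mul, if_neg (by simp [h]), h, Nat.cast_zero, zero_mul]
  · obtain ⟨m', rfl⟩ : ∃ m', m = m' + Finsupp.single i 1 :=
      ⟨m - Finsupp.single i 1,
        (tsub_add_cancel_of_le (by simpa using Nat.one_le_iff_ne_zero.2 h)).symm⟩
    rw [add_comm m', X, coeff_add_monomial_mul, coeff_pderiv]
    simp [add_comm, mul_comm]

lemma coeff_alongLinear (p q : ℕ) (H : MvPowerSeries (Fin 2) 𝕜) (m : Fin 2 →₀ ℕ) :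
    coeff m (alongLinear p q H) = ((p : 𝕜) * m 0 - q * m 1) * coeff m H := by
  have e : alongLinear p q H = (p : 𝕜) • (X 0 * pderiv 𝕜 0 H) - (q : 𝕜) • (X 1 * pderiv 𝕜 1 H) := by
    simp only [alongLinear, alongField, smul_eq_C_mul, map_natCast]; ring
  rw [e, map_sub, coeff_smul, coeff_smul, coeff_X_mul_pderiv, coeff_X_mul_pderiv]
  ring

lemma VanishesBelow.alongField {N : ℕ} {A B H : MvPowerSeries (Fin 2) 𝕜}
    (hA : VanishesBelow 2 A) (hB : VanishesBelow 2 B) (hH : VanishesBelow N H) :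
    VanishesBelow (N + 1) (alongField A B H) := by
  rcases N with _ | N
  · exact ((hA.mono one_le_two).mul (M := 0) fun m hm => by simp at hm).add
      ((hB.mono one_le_two).mul (M := 0) fun m hm => by simp at hm)
  · have := (hA.mul (hH.pderiv 0)).add (hB.mul (hH.pderiv 1))
    exact this.mono (by omega)

lemma SupportedMod.alongField {D a : ℕ} {A B H : MvPowerSeries (Fin 2) 𝕜}
    (hA : SupportedMod D 1 A) (hB : SupportedMod D 1 B) (hH : SupportedMod D (a + 1) H) :
    SupportedMod D (a + 1) (alongField A B H) := by
  have := (hA.mul (hH.pderiv 0)).add (hB.mul (hH.pderiv 1))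
  rwa [add_comm 1 a] at this

/-! ### Formal normalization -/

/-- The solution `K` of `(p x ∂/∂x - q y ∂/∂y) K = -F` up to resonant terms; the convention
`0⁻¹ = 0` makes the resonant coefficients of `K` zero. -/
def solveLinear (p q : ℕ) (F : MvPowerSeries (Fin 2) 𝕜) : MvPowerSeries (Fin 2) 𝕜 :=
  fun m => -((p : 𝕜) * m 0 - q * m 1)⁻¹ * coeff m F

lemma coeff_solveLinear (p q : ℕ) (F : MvPowerSeries (Fin 2) 𝕜) (m : Fin 2 →₀ ℕ) :
    coeff m (solveLinear p q F) = -((p : 𝕜) * m 0 - q * m 1)⁻¹ * coeff m F := rfl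

lemma VanishesBelow.solveLinear {N p q : ℕ} {F : MvPowerSeries (Fin 2) 𝕜}
    (hF : VanishesBelow N F) : VanishesBelow N (solveLinear p q F) :=
  fun m hm => by rw [coeff_solveLinear, hF m hm, mul_zero]

lemma SupportedMod.solveLinear {D a p q : ℕ} {F : MvPowerSeries (Fin 2) 𝕜}
    (hF : SupportedMod D a F) : SupportedMod D a (solveLinear p q F) :=
  fun m hm => by rw [coeff_solveLinear, hF m hm, mul_zero]

/-- The map `K ↦ solveLinear (F + (A ∂/∂x + B ∂/∂y) K)`, whose fixed point removes the nonresonant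
terms of `F`. It gains one order of agreement at each step when `A` and `B` have order at least
two. -/
def correctionStep (p q : ℕ) (A B F K : MvPowerSeries (Fin 2) 𝕜) : MvPowerSeries (Fin 2) 𝕜 :=
  solveLinear p q (F + alongField A B K)

/-- The fixed point of `correctionStep`: its coefficients of degree `d` are those of the iterate
number `d + 1`. -/
def correction (p q : ℕ) (A B F : MvPowerSeries (Fin 2) 𝕜) : MvPowerSeries (Fin 2) 𝕜 :=
  fun m => coeff m ((correctionStep p q A B F)^[m.degree + 1] 0)

section Correction

variable {p q : ℕ} {A B F : MvPowerSeries (Fin 2) 𝕜}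

lemma correctionStep_contracts (hA : VanishesBelow 2 A) (hB : VanishesBelow 2 B) {N : ℕ}
    {K K' : MvPowerSeries (Fin 2) 𝕜} (h : VanishesBelow N (K - K')) :
    VanishesBelow (N + 1) (correctionStep p q A B F K - correctionStep p q A B F K') := by
  have e : correctionStep p q A B F K - correctionStep p q A B F K' =
      solveLinear p q (alongField A B (K - K')) := by
    ext m
    rw [alongField_sub]
    simp only [correctionStep, coeff_solveLinear, map_sub, map_add]
    ring
  rw [e]
  exact (hA.alongField hB h).solveLinear

lemma iterate_correctionStep_succ_sub (hA : VanishesBelow 2 A) (hB : VanishesBelow 2 B) (N : ℕ) :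
    VanishesBelow N ((correctionStep p q A B F)^[N + 1] 0 - (correctionStep p q A B F)^[N] 0) := by
  induction N with
  | zero => exact fun m hm => by simp at hm
  | succ N ih =>
    rw [Function.iterate_succ_apply' _ (N + 1), Function.iterate_succ_apply' _ N] at *
    exact correctionStep_contracts hA hB ih

lemma coeff_iterate_correctionStep (hA : VanishesBelow 2 A) (hB : VanishesBelow 2 B)
    {m : Fin 2 →₀ ℕ} {N : ℕ} (hN : m.degree < N) :
    coeff m ((correctionStep p q A B F)^[N] 0) = coeff m (correction p q A B F) := by
  induction N, hN using Nat.le_induction with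
  | base => rfl
  | succ N hN ih =>
    rw [← ih, ← sub_eq_zero, ← map_sub]
    exact iterate_correctionStep_succ_sub hA hB N m hN

lemma correctionStep_correction (hA : VanishesBelow 2 A) (hB : VanishesBelow 2 B) :
    correctionStep p q A B F (correction p q A B F) = correction p q A B F := by
  ext m
  have h : VanishesBelow (m.degree + 1) (correction p q A B F -
      (correctionStep p q A B F)^[m.degree + 1] 0) := fun m' hm' => by
    rw [map_sub, coeff_iterate_correctionStep hA hB hm', sub_self]
  have := correctionStep_contracts (p := p) (q := q) (F := F) hA hB h m (by omega)
  rw [map_sub, sub_eq_zero, ← Function.iterate_succ_apply' (correctionStep p q A B F)] at this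
  rw [this, coeff_iterate_correctionStep hA hB (by omega)]

/-- Adding the correction removes every nonresonant term of `F`. -/
lemma coeff_add_correction_eq_zero (hA : VanishesBelow 2 A) (hB : VanishesBelow 2 B)
    {m : Fin 2 →₀ ℕ} (hm : (p : 𝕜) * m 0 - q * m 1 ≠ 0) :
    coeff m (F + (alongLinear p q (correction p q A B F) +
      alongField A B (correction p q A B F))) = 0 := by
  have h := congrArg (coeff m) (correctionStep_correction (p := p) (q := q) (F := F) hA hB)
  rw [correctionStep, coeff_solveLinear] at h
  rw [add_left_comm, map_add, coeff_alongLinear, ← h]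
  field_simp
  ring

lemma vanishesBelow_correction (hA : VanishesBelow 2 A) (hB : VanishesBelow 2 B) {N : ℕ}
    (h : VanishesBelow N (solveLinear p q F)) : VanishesBelow N (correction p q A B F) := by
  have key : ∀ M, VanishesBelow N ((correctionStep p q A B F)^[M] 0) := by
    intro M
    induction M with
    | zero => exact fun m _ => by simp
    | succ M ih =>
      rw [Function.iterate_succ_apply']
      have e : ∀ K, correctionStep p q A B F K =
          solveLinear p q F + solveLinear p q (alongField A B K) := fun K => by
        ext m
        simp only [correctionStep, coeff_solveLinear, map_add]
        ring
      rw [e]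
      exact h.add ((hA.alongField hB ih).mono (Nat.le_succ N)).solveLinear
  exact fun m hm => key _ m hm

lemma supportedMod_correction {D a : ℕ} (hA : SupportedMod D 1 A) (hB : SupportedMod D 1 B)
    (hF : SupportedMod D (a + 1) F) : SupportedMod D (a + 1) (correction p q A B F) := by
  have key : ∀ M, SupportedMod D (a + 1) ((correctionStep p q A B F)^[M] 0) := by
    intro M
    induction M with
    | zero => exact fun m _ => by simp
    | succ M ih =>
      rw [Function.iterate_succ_apply']
      exact (hF.add (hA.alongField hB ih)).solveLinear
  exact fun m hm => key _ m hm

end Correction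

/-! ### Resonant monomials -/

lemma resExp_zero (p q : ℕ) : resExp p q 0 = q := by simp [resExp]

lemma resExp_one (p q : ℕ) : resExp p q 1 = p := by simp [resExp]

lemma degree_resExp (p q : ℕ) : (resExp p q).degree = p + q := by
  rw [resExp, map_add, Finsupp.degree_single, Finsupp.degree_single, add_comm]

lemma degree_smul_resExp (p q k : ℕ) : (k • resExp p q).degree = k * (p + q) := by
  rw [map_nsmul, degree_resExp, smul_eq_mul]

lemma alongLinear_monomial_resExp (p q : ℕ) :
    alongLinear p q (monomial (resExp p q) (1 : 𝕜)) = 0 := by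
  classical
  ext m
  rw [coeff_alongLinear, coeff_monomial]
  split_ifs with h
  · rw [h, resExp_zero, resExp_one, map_zero]; ring
  · simp

lemma exists_eq_smul_resExp [CharZero 𝕜] {p q : ℕ} (hp : 0 < p) (hpq : Nat.Coprime p q)
    {m : Fin 2 →₀ ℕ} (hm : (p : 𝕜) * m 0 - q * m 1 = 0) : ∃ k : ℕ, m = k • resExp p q := by
  have h : p * m 0 = q * m 1 := by exact_mod_cast sub_eq_zero.1 hm
  obtain ⟨k, hk⟩ : p ∣ m 1 := hpq.dvd_of_dvd_mul_left (h ▸ dvd_mul_right _ _)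
  refine ⟨k, Finsupp.ext fun i => ?_⟩
  have h0 : m 0 = q * k := by
    rw [hk] at h
    exact Nat.eq_of_mul_eq_mul_left hp (by rw [h]; ring)
  fin_cases i
  · simp [resExp_zero, h0, mul_comm]
  · simp [resExp_one, hk, mul_comm]

/-- Approximate first integrals compute the saddle order: if the derivative of
`H = x ^ q y ^ p + ...` is a nonzero multiple of a power of the resonant monomial up to terms of
higher degree, then these terms can be normalized without affecting the leading one. -/
lemma hasSaddleOrder_of_leading [CharZero 𝕜] {p q : ℕ} (hp : 0 < p) (hpq : Nat.Coprime p q)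
    {P Q : MvPolynomial (Fin 2) 𝕜} (hP : IsNonlinear P) (hQ : IsNonlinear Q)
    {H : MvPowerSeries (Fin 2) 𝕜} {κ : ℕ} (hκ : 1 ≤ κ)
    (hH : VanishesBelow (p + q + 1) (H - monomial (resExp p q) 1))
    (hlow : ∀ m : Fin 2 →₀ ℕ, m.degree ≤ (κ + 1) * (p + q) → m ≠ (κ + 1) • resExp p q →
      coeff m (lieDeriv p q P Q H) = 0)
    (hlead : coeff ((κ + 1) • resExp p q) (lieDeriv p q P Q H) ≠ 0) :
    HasSaddleOrder p q P Q κ := by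
  have hP' : VanishesBelow 2 (P : MvPowerSeries (Fin 2) 𝕜) := fun m hm => by
    rw [MvPolynomial.coeff_coe]; exact hP m (by omega)
  have hQ' : VanishesBelow 2 (Q : MvPowerSeries (Fin 2) 𝕜) := fun m hm => by
    rw [MvPolynomial.coeff_coe]; exact hQ m (by omega)
  set F := lieDeriv p q P Q H with hF
  set K := correction p q (P : MvPowerSeries (Fin 2) 𝕜) Q F with hK
  have hres : ∀ k : ℕ, (p : 𝕜) * (k • resExp p q) 0 - q * (k • resExp p q) 1 = 0 := fun k => by
    simp [resExp_zero, resExp_one]; ring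
  have hKlow : VanishesBelow ((κ + 1) * (p + q) + 1) K := by
    refine vanishesBelow_correction hP' hQ' fun m hm => ?_
    rw [coeff_solveLinear]
    by_cases h : m = (κ + 1) • resExp p q
    · rw [h, hres, inv_zero, neg_zero, zero_mul]
    · rw [hlow m (by omega) h, mul_zero]
  have hD : lieDeriv p q P Q (H + K) = F + (alongLinear p q K + alongField P Q K) := by
    rw [hF, lieDeriv_eq, lieDeriv_eq, alongLinear_add, alongField_add]; ring
  have hlowD : ∀ m : Fin 2 →₀ ℕ, m.degree ≤ (κ + 1) * (p + q) →
      coeff m (lieDeriv p q P Q (H + K)) = coeff m F := fun m hm => by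
    rw [hD, map_add, map_add, coeff_alongLinear, hKlow m (by omega),
      (hP'.alongField hQ' hKlow) m (by omega)]
    ring
  refine ⟨hκ, fun k => coeff ((k + 1) • resExp p q) (lieDeriv p q P Q (H + K)),
    ⟨H + K, fun m hm => ?_, fun _ _ => rfl, fun m hm => ?_⟩, ?_, fun j hj hjκ => ?_⟩
  · have h1 := hH m (by omega)
    rw [map_sub, sub_eq_zero] at h1
    rw [map_add, h1, hKlow m (by nlinarith), add_zero]
  · by_cases h : (p : 𝕜) * m 0 - q * m 1 = 0
    · obtain ⟨k, rfl⟩ := exists_eq_smul_resExp hp hpq h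
      have hk : k ≤ 1 := by
        by_contra hk
        exact hm (k - 1) (by omega) (by congr 1; omega)
      have hne : k • resExp p q ≠ (κ + 1) • resExp p q := hm κ hκ
      have hdeg : (k • resExp p q).degree ≤ (κ + 1) * (p + q) := by
        rw [degree_smul_resExp]; exact Nat.mul_le_mul_right _ (by omega)
      rw [hlowD _ hdeg, hlow _ hdeg hne]
    · rw [hD]
      exact coeff_add_correction_eq_zero hP' hQ' h
  · beta_reduce
    rw [hlowD _ (degree_smul_resExp ..).le]; exact hlead
  · beta_reduce
    have hdeg : ((j + 1) • resExp p q).degree ≤ (κ + 1) * (p + q) := by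
      rw [degree_smul_resExp]; exact Nat.mul_le_mul_right _ (by omega)
    rw [hlowD _ hdeg, hlow _ hdeg]
    intro h
    have := congrArg Finsupp.degree h
    rw [degree_smul_resExp, degree_smul_resExp] at this
    have := Nat.eq_of_mul_eq_mul_right (by omega) this
    omega

end Formal

/-! ### A matrix of binomial coefficients -/

/-- The polynomial in `x` whose value at a positive integer `x` is
`(n x + S + 1 - i).choose ((n - 1) x + 1)`, `n = S + T`, times a nonzero factor that does not depend
on `i` (see `eval_binomPoly_natCast`). -/
def binomPoly (𝕜 : Type*) [Field 𝕜] (S T i : ℕ) : Polynomial 𝕜 :=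
  (∏ t ∈ range (S + T + 1 - i),
    (Polynomial.C ((S + T : ℕ) : 𝕜) * Polynomial.X + Polynomial.C ((t : 𝕜) + 1 - T))) *
  ∏ t ∈ range i, (Polynomial.X + Polynomial.C ((S : 𝕜) - t))

section BinomPoly

variable {𝕜 : Type*} [Field 𝕜] {S T : ℕ}

lemma eval_binomPoly (i : ℕ) (x : 𝕜) :
    (binomPoly 𝕜 S T i).eval x =
      (∏ t ∈ range (S + T + 1 - i), (((S + T : ℕ) : 𝕜) * x + ((t : 𝕜) + 1 - T))) *
        ∏ t ∈ range i, (x + ((S : 𝕜) - t)) := by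
  simp [binomPoly, Polynomial.eval_prod]

lemma natDegree_binomPoly_le {i : ℕ} (hi : i ≤ S + T + 1) :
    (binomPoly 𝕜 S T i).natDegree ≤ S + T + 1 := by
  refine Polynomial.natDegree_mul_le.trans ?_
  have h1 : (∏ t ∈ range (S + T + 1 - i), (Polynomial.C ((S + T : ℕ) : 𝕜) * Polynomial.X +
      Polynomial.C ((t : 𝕜) + 1 - T))).natDegree ≤ S + T + 1 - i := by
    refine (Polynomial.natDegree_prod_le _ _).trans ?_
    refine (Finset.sum_le_card_nsmul _ _ 1 fun t _ => Polynomial.natDegree_linear_le).trans ?_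
    simp
  have h2 : (∏ t ∈ range i, (Polynomial.X + Polynomial.C ((S : 𝕜) - t))).natDegree ≤ i := by
    refine (Polynomial.natDegree_prod_le _ _).trans ?_
    refine (Finset.sum_le_card_nsmul _ _ 1 fun t _ => ?_).trans (by simp)
    exact (Polynomial.natDegree_X_add_C _).le
  omega

/-- The first product contains the factor `n x - k` exactly when `i < S + 2 + k`. -/
lemma eval_binomPoly_eq_zero_left {i k : ℕ} {x : 𝕜} (hx : ((S + T : ℕ) : 𝕜) * x = k)
    (hk : k < T) (hi : i < S + 2 + k) : (binomPoly 𝕜 S T i).eval x = 0 := by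
  rw [eval_binomPoly, prod_eq_zero (i := T - 1 - k), zero_mul]
  · rw [mem_range]; omega
  · rw [hx, Nat.cast_sub (by omega), Nat.cast_sub (by omega)]
    push_cast; ring

lemma eval_binomPoly_eq_zero_right {i k : ℕ} (hk : k ≤ S) (hi : S - k < i) :
    (binomPoly 𝕜 S T i).eval (-(k : 𝕜)) = 0 := by
  rw [eval_binomPoly, prod_eq_zero (s := range i) (i := S - k), mul_zero]
  · rwa [mem_range]
  · rw [Nat.cast_sub hk]; ring

lemma eval_binomPoly_zero (hT : 0 < T) (i : ℕ) : (binomPoly 𝕜 S T i).eval 0 = 0 := by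
  rcases le_or_gt i (S + 1) with h | h
  · exact eval_binomPoly_eq_zero_left (k := 0) (by simp) hT (by omega)
  · simpa using eval_binomPoly_eq_zero_right (𝕜 := 𝕜) (S := S) (T := T) (i := i) (k := 0)
      (by omega) (by omega)

lemma eval_binomPoly_natCast {i A : ℕ} (hT : 0 < T) (hA : 0 < A) (hi : i ≤ S + T + 1) :
    (binomPoly 𝕜 S T i).eval (A : 𝕜) * (((S + T) * A - T).factorial : 𝕜) =
      ((S + T + 1 - i + ((S + T) * A - T)).choose ((S + T - 1) * A + 1) : 𝕜) *
        ((((S + T - 1) * A + 1).factorial : 𝕜) * ((A + S).factorial : 𝕜)) := by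
  have hTA : T ≤ (S + T) * A := by nlinarith
  obtain ⟨Z, hZ⟩ := Nat.exists_eq_add_of_le hTA
  have e1 : ∏ t ∈ range (S + T + 1 - i), (((S + T : ℕ) : 𝕜) * A + ((t : 𝕜) + 1 - T)) =
      ((Z + 1).ascFactorial (S + T + 1 - i) : 𝕜) := by
    rw [Nat.ascFactorial_eq_prod_range, Nat.cast_prod]
    refine prod_congr rfl fun t _ => ?_
    have : ((S + T : ℕ) : 𝕜) * A = T + Z := by exact_mod_cast congrArg (Nat.cast : ℕ → 𝕜) hZ
    rw [this]; push_cast; ring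
  have e2 : ∏ t ∈ range i, ((A : 𝕜) + ((S : 𝕜) - t)) = ((A + S).descFactorial i : 𝕜) := by
    rcases le_or_gt i (A + S) with h | h
    · rw [Nat.descFactorial_eq_prod_range, Nat.cast_prod]
      refine prod_congr rfl fun t ht => ?_
      rw [mem_range] at ht
      rw [Nat.cast_sub (by omega)]; push_cast; ring
    · rw [Nat.descFactorial_of_lt h, Nat.cast_zero]
      refine prod_eq_zero (i := A + S) (mem_range.2 h) ?_
      push_cast; ring
  rw [eval_binomPoly, e1, e2, hZ, Nat.add_sub_cancel_left]
  norm_cast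
  refine congrArg Nat.cast ?_
  have e3 : Z.factorial * (Z + 1).ascFactorial (S + T + 1 - i) =
      (Z + (S + T + 1 - i)).factorial := Nat.factorial_mul_ascFactorial _ _
  have hK : (S + T - 1) * A + A = T + Z := by
    rw [← hZ]
    obtain ⟨u, hu⟩ := Nat.exists_eq_add_of_lt (show 0 < S + T by omega)
    rw [hu, zero_add, Nat.add_sub_cancel]; ring
  rcases le_or_gt i (A + S) with h | h
  · have e4 := Nat.factorial_mul_descFactorial h
    have e5 := Nat.choose_mul_factorial_mul_factorial
      (n := S + T + 1 - i + Z) (k := (S + T - 1) * A + 1) (by omega)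
    rw [show S + T + 1 - i + Z - ((S + T - 1) * A + 1) = A + S - i by omega, add_comm _ Z, ← e3] at e5
    rw [add_comm _ Z, ← e4]
    calc _ = (Z.factorial * (Z + 1).ascFactorial (S + T + 1 - i)) * (A + S).descFactorial i := by
          ring
      _ = _ := by rw [← e5]; ring
  · rw [Nat.descFactorial_of_lt h, Nat.choose_eq_zero_of_lt (by omega)]
    simp

end BinomPoly

/-- The square matrix with rows `j = 1, …, n + 1`, `n = S + T`, and columns `i = 0, …, n + 1`,
`i ≠ S + 2`, of entries `(n p j + S + 1 - i).choose ((n - 1) p j + 1)` is invertible. -/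
lemma eq_zero_of_sum_mul_choose_eq_zero {𝕜 : Type*} [Field 𝕜] [CharZero 𝕜] {S T p : ℕ}
    (hS : 0 < S) (hT : 1 < T) (hp : 0 < p) {d : ℕ → 𝕜} (hd : d (S + 2) = 0)
    (h : ∀ j ∈ Icc 1 (S + T + 1), ∑ i ∈ range (S + T + 2), d i *
      ((S + T + 1 - i + ((S + T) * (p * j) - T)).choose ((S + T - 1) * (p * j) + 1) : 𝕜) = 0)
    {i : ℕ} (hi : i < S + T + 2) : d i = 0 := by
  -- the combination of the polynomials has too many roots: `0, p, …, (n + 1) p`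
  have hpoly : ∑ i ∈ range (S + T + 2), Polynomial.C (d i) * binomPoly 𝕜 S T i = 0 := by
    refine Polynomial.eq_zero_of_natDegree_lt_card_of_eval_eq_zero (ι := Fin (S + T + 2)) _
      (f := fun j => ((p * (j : ℕ) : ℕ) : 𝕜)) ?_ (fun j => ?_) ?_
    · intro a b hab
      have := Nat.cast_injective hab
      exact Fin.ext (Nat.eq_of_mul_eq_mul_left hp this)
    · simp only [Polynomial.eval_finsetSum, Polynomial.eval_mul, Polynomial.eval_C]
      rcases Nat.eq_zero_or_pos (j : ℕ) with hj | hj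
      · simp [hj, eval_binomPoly_zero (by omega : 0 < T)]
      · have hA : 0 < p * (j : ℕ) := Nat.mul_pos hp hj
        have hfac : ((((S + T) * (p * (j : ℕ)) - T).factorial : ℕ) : 𝕜) ≠ 0 :=
          Nat.cast_ne_zero.2 (Nat.factorial_ne_zero _)
        refine (mul_eq_zero.1 ?_).resolve_right hfac
        rw [sum_mul]
        have := h j (mem_Icc.2 ⟨hj, by omega⟩)
        rw [← zero_mul ((((S + T - 1) * (p * (j : ℕ)) + 1).factorial : 𝕜) *
          ((p * (j : ℕ) + S).factorial : 𝕜)), ← this, sum_mul]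
        refine sum_congr rfl fun i hi => ?_
        rw [mem_range] at hi
        rw [mul_assoc, eval_binomPoly_natCast (by omega) hA (by omega), mul_assoc]
    · rw [Fintype.card_fin]
      refine lt_of_le_of_lt (Polynomial.natDegree_sum_le_of_forall_le (n := S + T + 1) _ _
        fun i hi => ?_) (Nat.lt_succ_self _)
      rw [mem_range] at hi
      exact (Polynomial.natDegree_C_mul_le _ _).trans (natDegree_binomPoly_le (by omega))
  have heval : ∀ x : 𝕜, ∑ i ∈ range (S + T + 2), d i * (binomPoly 𝕜 S T i).eval x = 0 :=
    fun x => by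
      have := congrArg (Polynomial.eval x) hpoly
      simpa [Polynomial.eval_finsetSum] using this
  -- a point where only the term `i` survives forces `d i = 0`
  have hsingle : ∀ i < S + T + 2, ∀ x : 𝕜,
      (∀ i' < S + T + 2, i' ≠ i → d i' = 0 ∨ (binomPoly 𝕜 S T i').eval x = 0) →
      (binomPoly 𝕜 S T i).eval x ≠ 0 → d i = 0 := by
    intro i hi x hx hne
    have := heval x
    rw [sum_eq_single i (fun i' hi' hne' => ?_) (fun h' => absurd (mem_range.2 hi) h')] at this
    · exact (mul_eq_zero.1 this).resolve_right hne
    · rcases hx i' (mem_range.1 hi') hne' with h0 | h0 <;> rw [h0] <;> simp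
  have hn : ((S + T : ℕ) : 𝕜) ≠ 0 := Nat.cast_ne_zero.2 (by omega)
  have hcast : ∀ z : ℤ, z ≠ 0 → (z : 𝕜) ≠ 0 := fun z hz => Int.cast_ne_zero.2 hz
  -- `i < S`: evaluate at `x = i - S`
  have hlow : ∀ i < S, d i = 0 := by
    intro i
    induction i using Nat.strong_induction_on with
    | _ i ih =>
      intro hiS
      refine hsingle i (by omega) (-((S - i : ℕ) : 𝕜)) (fun i' _ hne => ?_) ?_
      · rcases lt_or_gt_of_ne hne with h' | h'
        · exact Or.inl (ih i' h' (by omega))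
        · exact Or.inr (eval_binomPoly_eq_zero_right (by omega) (by omega))
      · rw [eval_binomPoly]
        refine mul_ne_zero (prod_ne_zero_iff.2 fun t ht => ?_) (prod_ne_zero_iff.2 fun t ht => ?_)
        · rw [mem_range] at ht
          have := hcast (((S + T : ℕ) : ℤ) * -((S - i : ℕ) : ℤ) + ((t : ℤ) + 1 - T)) (by
            have : ((S + T : ℕ) : ℤ) * 1 ≤ ((S + T : ℕ) : ℤ) * ((S - i : ℕ) : ℤ) :=
              mul_le_mul_of_nonneg_left (by omega) (by omega)
            rw [mul_neg]
            omega)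
          exact_mod_cast this
        · rw [mem_range] at ht
          rw [Nat.cast_sub hiS.le]
          have := hcast ((i : ℤ) - t) (by omega)
          push_cast at this
          convert this using 1
          ring
  -- `i > S + 2`: evaluate at `x = (i - S - 2) / n`
  have hdiv : ∀ (a : ℤ) (t : ℕ), ¬ ((S + T : ℕ) : ℤ) ∣ a →
      (a : 𝕜) / ((S + T : ℕ) : 𝕜) + ((S : 𝕜) - t) ≠ 0 := by
    intro a t ha h0
    have h1 : (a : 𝕜) + ((S + T : ℕ) : 𝕜) * ((S : 𝕜) - t) = 0 := by
      rw [div_add' _ _ _ hn, div_eq_zero_iff] at h0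
      rw [← h0.resolve_right hn]; ring
    have h2 : a + ((S + T : ℕ) : ℤ) * ((S : ℤ) - t) = 0 := by exact_mod_cast h1
    exact ha ⟨-((S : ℤ) - t), by linarith⟩
  have hhigh : ∀ k l : ℕ, k + l + 1 = T → 1 ≤ k → d (S + 2 + k) = 0 := by
    intro k l
    induction l using Nat.strong_induction_on generalizing k with
    | _ l ih =>
      intro hkl hk
      have hx : ((S + T : ℕ) : 𝕜) * (((k : ℤ) : 𝕜) / ((S + T : ℕ) : 𝕜)) = k := by
        rw [mul_div_cancel₀ _ hn, Int.cast_natCast]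
      refine hsingle _ (by omega) (((k : ℤ) : 𝕜) / ((S + T : ℕ) : 𝕜)) (fun i' hi' hne => ?_) ?_
      · rcases lt_or_gt_of_ne hne with h' | h'
        · exact Or.inr (eval_binomPoly_eq_zero_left hx (by omega) h')
        · left
          have := ih (S + 2 + k + l - i') (by omega) (i' - S - 2) (by omega) (by omega)
          rwa [show S + 2 + (i' - S - 2) = i' by omega] at this
      · rw [eval_binomPoly, hx]
        refine mul_ne_zero (prod_ne_zero_iff.2 fun t ht => ?_)
          (prod_ne_zero_iff.2 fun t ht => hdiv _ _ ?_)
        · rw [mem_range] at ht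
          have := hcast ((k : ℤ) + (t + 1 - T)) (by omega)
          exact_mod_cast this
        · intro hdvd
          have := Int.le_of_dvd (by omega) hdvd
          omega
  -- the column `S + 1`: evaluate at `x = -1 / n`
  have hS1 : d (S + 1) = 0 := by
    have hx : ((S + T : ℕ) : 𝕜) * (((-1 : ℤ) : 𝕜) / ((S + T : ℕ) : 𝕜)) = -1 := by
      rw [mul_div_cancel₀ _ hn]; simp
    refine hsingle _ (by omega) (((-1 : ℤ) : 𝕜) / ((S + T : ℕ) : 𝕜)) (fun i' hi' hne => ?_) ?_
    · rcases lt_or_ge i' S with h' | h'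
      · exact Or.inl (hlow i' h')
      rcases h'.eq_or_lt with rfl | h'
      · right
        rw [eval_binomPoly, hx, prod_eq_zero (i := T), zero_mul]
        · rw [mem_range]; omega
        · ring
      rcases (show i' = S + 2 ∨ S + 2 < i' by omega) with rfl | h''
      · exact Or.inl hd
      · left
        have := hhigh (i' - S - 2) (S + T + 1 - i') (by omega) (by omega)
        rwa [show S + 2 + (i' - S - 2) = i' by omega] at this
    · rw [eval_binomPoly, hx]
      refine mul_ne_zero (prod_ne_zero_iff.2 fun t ht => ?_)
        (prod_ne_zero_iff.2 fun t ht => hdiv _ _ ?_)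
      · rw [mem_range] at ht
        have := hcast ((-1 : ℤ) + (t + 1 - T)) (by omega)
        exact_mod_cast this
      · intro hdvd
        have := Int.le_of_dvd (by norm_num) (Int.dvd_neg.2 hdvd)
        omega
  have hne : ∀ i', i' ≠ S → i' < S + T + 2 → d i' = 0 := by
    intro i' hne hi'
    rcases lt_or_gt_of_ne hne with h' | h'
    · exact hlow i' h'
    rcases (show i' = S + 1 ∨ i' = S + 2 ∨ S + 2 < i' by omega) with rfl | rfl | h''
    · exact hS1
    · exact hd
    · have := hhigh (i' - S - 2) (S + T + 1 - i') (by omega) (by omega)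
      rwa [show S + 2 + (i' - S - 2) = i' by omega] at this
  rcases eq_or_ne i S with rfl | hiS
  · refine hsingle i hi 1 (fun i' hi' hne' => Or.inl (hne i' hne' hi')) ?_
    rw [eval_binomPoly]
    refine mul_ne_zero (prod_ne_zero_iff.2 fun t ht => ?_) (prod_ne_zero_iff.2 fun t ht => ?_)
    · have := hcast (((i + T : ℕ) : ℤ) * 1 + ((t : ℤ) + 1 - T)) (by push_cast; omega)
      exact_mod_cast this
    · rw [mem_range] at ht
      have := hcast ((1 : ℤ) + ((i : ℤ) - t)) (by omega)
      exact_mod_cast this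
  · exact hne i hiS hi

/-! ### Smooth dependence on parameters -/

section Smooth

variable {𝕜 E : Type*} [RCLike 𝕜] [NormedAddCommGroup E] [NormedSpace 𝕜 E]

/-- Every coefficient of the formal power series `G c` is a `C¹` function of the parameter `c`. -/
def ContDiffCoeffs (G : E → MvPowerSeries (Fin 2) 𝕜) : Prop :=
  ∀ m : Fin 2 →₀ ℕ, ContDiff 𝕜 1 fun c => coeff m (G c)

namespace ContDiffCoeffs

variable {G G' : E → MvPowerSeries (Fin 2) 𝕜}

lemma const (F : MvPowerSeries (Fin 2) 𝕜) : ContDiffCoeffs fun _ : E => F :=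
  fun _ => contDiff_const

lemma add (h : ContDiffCoeffs G) (h' : ContDiffCoeffs G') :
    ContDiffCoeffs fun c => G c + G' c := fun m => by
  simpa only [map_add] using (h m).add (h' m)

lemma sum {ι : Type*} (s : Finset ι) {f : ι → E → MvPowerSeries (Fin 2) 𝕜}
    (h : ∀ i ∈ s, ContDiffCoeffs (f i)) : ContDiffCoeffs fun c => ∑ i ∈ s, f i c := fun m => by
  simpa only [map_sum] using ContDiff.sum fun i hi => h i hi m

lemma smul {a : E → 𝕜} (ha : ContDiff 𝕜 1 a) (h : ContDiffCoeffs G) :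
    ContDiffCoeffs fun c => a c • G c := fun m => by
  simpa only [coeff_smul] using ha.mul (h m)

lemma mul (h : ContDiffCoeffs G) (h' : ContDiffCoeffs G') :
    ContDiffCoeffs fun c => G c * G' c := fun m => by
  classical
  simp only [coeff_mul]
  exact ContDiff.sum fun x _ => (h _).mul (h' _)

lemma pderiv (i : Fin 2) (h : ContDiffCoeffs G) :
    ContDiffCoeffs fun c => MvPowerSeries.pderiv 𝕜 i (G c) := fun m => by
  simp only [coeff_pderiv]
  exact (h _).mul contDiff_const

lemma alongField {A B : E → MvPowerSeries (Fin 2) 𝕜} (hA : ContDiffCoeffs A)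
    (hB : ContDiffCoeffs B) (h : ContDiffCoeffs G) :
    ContDiffCoeffs fun c => alongField (A c) (B c) (G c) :=
  (hA.mul (h.pderiv 0)).add (hB.mul (h.pderiv 1))

lemma correction {p q : ℕ} {A B : E → MvPowerSeries (Fin 2) 𝕜} (hA : ContDiffCoeffs A)
    (hB : ContDiffCoeffs B) (h : ContDiffCoeffs G) :
    ContDiffCoeffs fun c => correction p q (A c) (B c) (G c) := by
  have key : ∀ M : ℕ, ContDiffCoeffs fun c => (correctionStep p q (A c) (B c) (G c))^[M] 0 := by
    intro M
    induction M with
    | zero => exact const 0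
    | succ M ih =>
      simp only [Function.iterate_succ_apply']
      exact fun m => contDiff_const.mul (h.add (hA.alongField hB ih) m)
  exact fun m => key _ m

end ContDiffCoeffs

end Smooth

/-- A map `c ↦ (∑ i, c i φ i j (c))_j` has derivative `(φ i j 0)` at the origin; if this matrix is
invertible, the map is open at the origin. -/
lemma map_nhds_zero_sum_mul {𝕜 ι : Type*} [RCLike 𝕜] [Fintype ι]
    {φ : ι → ι → (ι → 𝕜) → 𝕜} (hφ : ∀ i j, ContDiff 𝕜 1 (φ i j))
    (hinj : ∀ v : ι → 𝕜, (∀ j, ∑ i, v i * φ i j 0 = 0) → v = 0) :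
    Filter.map (fun (c : ι → 𝕜) (j : ι) => ∑ i, c i * φ i j c) (nhds 0) = nhds 0 := by
  set Ψ' : (ι → 𝕜) →L[𝕜] (ι → 𝕜) :=
    ContinuousLinearMap.pi fun j => ∑ i, φ i j 0 • ContinuousLinearMap.proj i with hΨ'
  have hd : HasStrictFDerivAt (fun (c : ι → 𝕜) (j : ι) => ∑ i, c i * φ i j c) Ψ' 0 := by
    refine hasStrictFDerivAt_pi.2 fun j => ?_
    refine HasStrictFDerivAt.fun_sum fun i _ => ?_
    have h1 : HasStrictFDerivAt (fun c : ι → 𝕜 => c i)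
        (ContinuousLinearMap.proj (R := 𝕜) (φ := fun _ : ι => 𝕜) i) 0 :=
      (ContinuousLinearMap.proj (R := 𝕜) (φ := fun _ : ι => 𝕜) i).hasStrictFDerivAt
    have h2 := ((hφ i j).contDiffAt (x := 0)).hasStrictFDerivAt (by simp)
    refine (h1.mul h2).congr_fderiv ?_
    ext v
    simp
  have hker : Function.Injective (Ψ' : (ι → 𝕜) →ₗ[𝕜] (ι → 𝕜)) := by
    rw [injective_iff_map_eq_zero]
    intro v hv
    refine hinj v fun j => ?_
    have := congrFun hv j
    simpa [hΨ', mul_comm] using this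
  have hsurj := LinearMap.injective_iff_surjective.1 hker
  have := hd.map_nhds_eq_of_surj (LinearMap.range_eq_top.2 hsurj)
  rw [this]
  congr 1
  ext j
  simp

/-! ### Formal first integrals -/

section FirstIntegral

variable {𝕜 : Type*} [Field 𝕜]

/-- The series `x ^ q * y ^ p + ...` whose derivative along
`(p x + A) ∂/∂x + (-q y + B) ∂/∂y` has only resonant terms. -/
def normalIntegral (p q : ℕ) (A B : MvPowerSeries (Fin 2) 𝕜) : MvPowerSeries (Fin 2) 𝕜 :=
  monomial (resExp p q) 1 +
    correction p q A B (alongField A B (monomial (resExp p q) 1))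

variable {p q : ℕ} {A B : MvPowerSeries (Fin 2) 𝕜}

lemma vanishesBelow_monomial_resExp :
    VanishesBelow (p + q) (monomial (resExp p q) (1 : 𝕜)) := fun m hm => by
  classical
  rw [coeff_monomial, if_neg]
  rintro rfl
  rw [degree_resExp] at hm
  exact lt_irrefl _ hm

lemma vanishesBelow_normalIntegral_sub (hA : VanishesBelow 2 A) (hB : VanishesBelow 2 B) :
    VanishesBelow (p + q + 1) (normalIntegral p q A B - monomial (resExp p q) 1) := by
  rw [normalIntegral, add_sub_cancel_left]
  exact vanishesBelow_correction hA hB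
    (hA.alongField hB vanishesBelow_monomial_resExp).solveLinear

lemma coeff_normalIntegral_of_nonresonant (hA : VanishesBelow 2 A) (hB : VanishesBelow 2 B)
    {m : Fin 2 →₀ ℕ} (hm : (p : 𝕜) * m 0 - q * m 1 ≠ 0) :
    coeff m (alongLinear p q (normalIntegral p q A B) +
      alongField A B (normalIntegral p q A B)) = 0 := by
  rw [normalIntegral, alongLinear_add, alongLinear_monomial_resExp, zero_add, alongField_add,
    add_left_comm]
  exact coeff_add_correction_eq_zero hA hB hm

lemma coeff_smul_resExp_alongLinear (k : ℕ) (H : MvPowerSeries (Fin 2) 𝕜) :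
    coeff (k • resExp p q) (alongLinear p q H) = 0 := by
  rw [coeff_alongLinear]
  simp [resExp_zero, resExp_one]
  left; ring

lemma vanishesBelow_alongField_normalIntegral (hA : VanishesBelow 2 A) (hB : VanishesBelow 2 B) :
    VanishesBelow (p + q + 1) (alongField A B (normalIntegral p q A B)) := by
  refine hA.alongField hB ?_
  have := ((vanishesBelow_normalIntegral_sub (p := p) (q := q) hA hB).mono
    (Nat.le_succ _)).add vanishesBelow_monomial_resExp
  rwa [sub_add_cancel] at this

/-- If all terms of `A` and `B` have degree one modulo `D`, only those saddle values can be nonzero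
whose monomial has degree `p + q` modulo `D`. -/
lemma supportedMod_alongField_normalIntegral (hp : 0 < p) {D : ℕ} (hA : SupportedMod D 1 A)
    (hB : SupportedMod D 1 B) :
    SupportedMod D (p + q) (alongField A B (normalIntegral p q A B)) := by
  classical
  obtain ⟨a, ha⟩ : ∃ a, p + q = a + 1 := ⟨p + q - 1, by omega⟩
  have h0 : SupportedMod D (a + 1) (monomial (resExp p q) (1 : 𝕜)) := fun m hm => by
    rw [coeff_monomial, if_neg]
    rintro rfl
    rw [degree_resExp, ha] at hm
    exact hm rfl
  rw [ha]
  exact hA.alongField hB (h0.add (supportedMod_correction hA hB (hA.alongField hB h0)))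

end FirstIntegral

/-! ### Inverses of homogeneous perturbations of the constant one -/

section GeomInverse

variable {𝕜 : Type*} [Field 𝕜] {D : ℕ} {g : MvPolynomial (Fin 2) 𝕜}

/-- The series `∑ (-g) ^ s`, the inverse of `1 + g`, for a form `g` of degree `D`. -/
def geomInverse (D : ℕ) (g : MvPolynomial (Fin 2) 𝕜) : MvPowerSeries (Fin 2) 𝕜 :=
  fun m => if D ∣ m.degree then
    (-1) ^ (m.degree / D) * (g ^ (m.degree / D)).coeff m else 0

lemma coeff_geomInverse (m : Fin 2 →₀ ℕ) : coeff m (geomInverse D g) =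
    if D ∣ m.degree then (-1) ^ (m.degree / D) * (g ^ (m.degree / D)).coeff m else 0 := rfl

lemma supportedMod_geomInverse : SupportedMod D 0 (geomInverse D g) := fun m hm => by
  rw [coeff_geomInverse, if_neg]
  rwa [← Nat.modEq_zero_iff_dvd]

lemma coeff_geomInverse_mul (hD : 0 < D) {R : MvPolynomial (Fin 2) 𝕜} {a s : ℕ}
    (hR : R.IsHomogeneous a) {m : Fin 2 →₀ ℕ} (hm : m.degree = a + D * s) :
    coeff m (geomInverse D g * (R : MvPowerSeries (Fin 2) 𝕜)) =
      (-1) ^ s * (g ^ s * R).coeff m := by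
  classical
  rw [coeff_mul, MvPolynomial.coeff_mul, mul_sum]
  refine sum_congr rfl fun x hx => ?_
  rw [HasAntidiagonal.mem_antidiagonal] at hx
  have h : x.1.degree + x.2.degree = m.degree := by rw [← hx, map_add]
  rw [MvPolynomial.coeff_coe]
  by_cases h2 : x.2.degree = a
  · have h1 : x.1.degree = D * s := by omega
    rw [coeff_geomInverse, if_pos ⟨s, h1⟩, h1, Nat.mul_div_cancel_left _ hD, mul_assoc]
  · rw [hR.coeff_eq_zero h2]; simp

lemma one_add_mul_geomInverse (hD : 0 < D) (hg : g.IsHomogeneous D) :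
    (1 + (g : MvPowerSeries (Fin 2) 𝕜)) * geomInverse D g = 1 := by
  classical
  ext m
  rw [add_mul, one_mul, map_add, mul_comm, coeff_geomInverse, coeff_one]
  have hgS : SupportedMod D 0 (geomInverse D g * (g : MvPowerSeries (Fin 2) 𝕜)) := by
    have h : SupportedMod D D (g : MvPowerSeries (Fin 2) 𝕜) := fun m hm => by
      rw [MvPolynomial.coeff_coe]
      exact hg.coeff_eq_zero fun h => hm (h ▸ rfl)
    intro m hm
    refine supportedMod_geomInverse.mul h m fun h' => hm (h'.trans ?_)
    simp [Nat.ModEq]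
  have hgV : VanishesBelow D (geomInverse D g * (g : MvPowerSeries (Fin 2) 𝕜)) := by
    refine VanishesBelow.mul_left _ fun m hm => ?_
    rw [MvPolynomial.coeff_coe]
    exact hg.coeff_eq_zero hm.ne
  by_cases hdvd : D ∣ m.degree
  · obtain ⟨s, hs⟩ := hdvd
    rw [if_pos ⟨s, hs⟩, hs, Nat.mul_div_cancel_left _ hD]
    rcases s with _ | s
    · rw [hgV m (by rw [hs]; simpa using hD), add_zero, pow_zero, pow_zero, one_mul,
        MvPolynomial.coeff_one]
      simp [eq_comm]
    · rw [coeff_geomInverse_mul hD hg (s := s) (by rw [hs]; ring), if_neg, pow_succ, pow_succ]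
      · ring
      · rintro rfl
        simp at hs
        omega
  · rw [if_neg hdvd, hgS m (by rwa [Nat.modEq_zero_iff_dvd]), if_neg, add_zero]
    rintro rfl
    simp at hdvd

end GeomInverse

/-! ### The perturbed system -/

section Family

variable (𝕜 : Type*) [Field 𝕜]

/-- The form `g = x ^ (S - 1) * (x + y) ^ T` of degree `n - 1`, where `n = S + T`. -/
def baseForm (S T : ℕ) : MvPolynomial (Fin 2) 𝕜 :=
  MvPolynomial.X 0 ^ (S - 1) * (MvPolynomial.X 0 + MvPolynomial.X 1) ^ T

/-- The first component of the `i`-th perturbation. For `i ≤ n` the perturbations are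
`x ^ i (x + y) ^ (n - i) (p ∂/∂x + q ∂/∂y)`, and number `n + 1` is `q x ^ n ∂/∂y`; they are chosen
so that `pert_combination` has one form for all `i ≤ n + 1`. -/
def pertX (p n i : ℕ) : MvPolynomial (Fin 2) 𝕜 :=
  if i ≤ n then MvPolynomial.C (p : 𝕜) *
    (MvPolynomial.X 0 ^ i * (MvPolynomial.X 0 + MvPolynomial.X 1) ^ (n - i)) else 0

/-- The second component of the `i`-th perturbation. -/
def pertY (q n i : ℕ) : MvPolynomial (Fin 2) 𝕜 :=
  MvPolynomial.C (q : 𝕜) * if i ≤ n then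
    MvPolynomial.X 0 ^ i * (MvPolynomial.X 0 + MvPolynomial.X 1) ^ (n - i)
    else MvPolynomial.X 0 ^ n

variable {𝕜}

lemma isHomogeneous_pow_mul_pow (a b : ℕ) :
    (MvPolynomial.X 0 ^ a * (MvPolynomial.X 0 + MvPolynomial.X 1) ^ b :
      MvPolynomial (Fin 2) 𝕜).IsHomogeneous (a + b) := by
  have h1 := (MvPolynomial.isHomogeneous_X 𝕜 (0 : Fin 2)).pow a
  have h2 := ((MvPolynomial.isHomogeneous_X 𝕜 (0 : Fin 2)).add
    (MvPolynomial.isHomogeneous_X 𝕜 (1 : Fin 2))).pow b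
  simpa using h1.mul h2

lemma isHomogeneous_baseForm {S T : ℕ} (hS : 0 < S) :
    (baseForm 𝕜 S T).IsHomogeneous (S + T - 1) := by
  have := isHomogeneous_pow_mul_pow (𝕜 := 𝕜) (S - 1) T
  rwa [show S - 1 + T = S + T - 1 by omega] at this

lemma isHomogeneous_pertX (p n i : ℕ) : (pertX 𝕜 p n i).IsHomogeneous n := by
  rw [pertX]
  split_ifs with h
  · have := (isHomogeneous_pow_mul_pow (𝕜 := 𝕜) i (n - i)).C_mul (p : 𝕜)
    rwa [show i + (n - i) = n by omega] at this
  · exact MvPolynomial.isHomogeneous_zero _ _ _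

lemma isHomogeneous_pertY (q n i : ℕ) : (pertY 𝕜 q n i).IsHomogeneous n := by
  rw [pertY]
  refine MvPolynomial.IsHomogeneous.C_mul ?_ _
  split_ifs with h
  · have := isHomogeneous_pow_mul_pow (𝕜 := 𝕜) i (n - i)
    rwa [show i + (n - i) = n by omega] at this
  · simpa using (MvPolynomial.isHomogeneous_X 𝕜 (0 : Fin 2)).pow n

/-- Up to the factor `x ^ (q - 1) * y ^ (p - 1)`, this is the derivative of `x ^ q * y ^ p` along the
`i`-th perturbation. -/
lemma pert_combination {p q n i : ℕ} (hi : i ≤ n + 1) :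
    MvPolynomial.C (q : 𝕜) * MvPolynomial.X 1 * pertX 𝕜 p n i +
      MvPolynomial.C (p : 𝕜) * MvPolynomial.X 0 * pertY 𝕜 q n i =
    MvPolynomial.C ((p : 𝕜) * q) *
      (MvPolynomial.X 0 ^ i * (MvPolynomial.X 0 + MvPolynomial.X 1) ^ (n + 1 - i)) := by
  rw [pertX, pertY, MvPolynomial.C_mul]
  split_ifs with h
  · rw [show n + 1 - i = (n - i) + 1 by omega, pow_succ]; ring
  · obtain rfl : i = n + 1 := by omega
    simp; ring

/-- No condition `a ≤ m 0` is needed, since the binomial coefficient vanishes otherwise. -/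
lemma coeff_X_pow_mul_X_pow_mul_add_pow {a b N : ℕ} {m : Fin 2 →₀ ℕ}
    (hm : m.degree = a + b + N) (hb : b ≤ m 1) :
    MvPolynomial.coeff m (MvPolynomial.X 0 ^ a * MvPolynomial.X 1 ^ b *
      (MvPolynomial.X 0 + MvPolynomial.X 1) ^ N : MvPolynomial (Fin 2) 𝕜) =
      (N.choose (m 1 - b) : 𝕜) := by
  have hdeg : m.degree = m 0 + m 1 := by
    rw [Finsupp.degree_eq_sum, Fin.sum_univ_two]
  rw [MvPolynomial.X_pow_eq_monomial, MvPolynomial.X_pow_eq_monomial, MvPolynomial.monomial_mul,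
    one_mul, MvPolynomial.coeff_monomial_mul', one_mul, MvPolynomial.coeff_add_pow]
  by_cases h : a ≤ m 0
  · rw [if_pos, if_pos]
    · have : N - (m 1 - b) = m 0 - a := by omega
      simp only [Finsupp.tsub_apply, Finsupp.add_apply]
      simp [← this, Nat.choose_symm (show m 1 - b ≤ N by omega)]
    · simp; omega
    · intro i
      fin_cases i <;> simp [h, hb]
  · rw [if_neg, Nat.choose_eq_zero_of_lt (by omega), Nat.cast_zero]
    intro hle
    exact h (by simpa using hle 0)

lemma X_mul_pderiv_monomial (i : Fin 2) (e : Fin 2 →₀ ℕ) :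
    X i * pderiv 𝕜 i (monomial e (1 : 𝕜)) = C (e i : 𝕜) * monomial e 1 := by
  classical
  ext m
  rw [coeff_X_mul_pderiv, coeff_C_mul, coeff_monomial]
  split_ifs with h
  · rw [h]
  · simp

/-- The linear part of the saddle values: after division of the system by `1 + g`, the `i`-th
perturbation contributes a binomial coefficient to the saddle value number `(n - 1) j`. -/
lemma coeff_alongField_pert {p q m j : ℕ} (hp : 0 < p) (hq : 0 < q) (hm : 0 < m) (hj : 0 < j)
    {i : ℕ} (hi : i ≤ q * m + p * m + 1) :
    coeff (((q * m + p * m - 1) * j + 1) • resExp p q)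
      (alongField
        (geomInverse (q * m + p * m - 1) (baseForm 𝕜 (q * m) (p * m)) *
          (pertX 𝕜 p (q * m + p * m) i : MvPowerSeries (Fin 2) 𝕜))
        (geomInverse (q * m + p * m - 1) (baseForm 𝕜 (q * m) (p * m)) *
          (pertY 𝕜 q (q * m + p * m) i : MvPowerSeries (Fin 2) 𝕜))
        (monomial (resExp p q) 1)) =
    (-1) ^ ((p + q) * j - 1) * ((p : 𝕜) * q) *
      ((q * m + p * m + 1 - i + ((q * m + p * m) * (p * j) - p * m)).choose
        ((q * m + p * m - 1) * (p * j) + 1) : 𝕜) := by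
  classical
  have hS : 0 < q * m := Nat.mul_pos hq hm
  have hT : 0 < p * m := Nat.mul_pos hp hm
  obtain ⟨s, hs⟩ : ∃ s, (p + q) * j = s + 1 :=
    ⟨(p + q) * j - 1, (Nat.succ_pred_eq_of_pos (Nat.mul_pos (by omega) hj)).symm⟩
  set S := q * m with hSdef
  set T := p * m with hTdef
  obtain ⟨D, hD⟩ : ∃ D, S + T = D + 1 := ⟨S + T - 1, by omega⟩
  have hD0 : 0 < D := by omega
  have hSD : S + T - 1 = D := by omega
  rw [hSD]
  set I := geomInverse D (baseForm 𝕜 S T) with hI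
  set n := S + T with hn
  set M : Fin 2 →₀ ℕ := (D * j + 1) • resExp p q with hM
  set R : MvPolynomial (Fin 2) 𝕜 := MvPolynomial.C ((p : 𝕜) * q) *
    (MvPolynomial.X 0 ^ (i + q) * MvPolynomial.X 1 ^ p *
      (MvPolynomial.X 0 + MvPolynomial.X 1) ^ (n + 1 - i)) with hR
  have hRhom : R.IsHomogeneous (i + q + p + (n + 1 - i)) := by
    have h1 := (MvPolynomial.isHomogeneous_X 𝕜 (0 : Fin 2)).pow (i + q)
    have h2 := (MvPolynomial.isHomogeneous_X 𝕜 (1 : Fin 2)).pow p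
    have h3 := ((MvPolynomial.isHomogeneous_X 𝕜 (0 : Fin 2)).add
      (MvPolynomial.isHomogeneous_X 𝕜 (1 : Fin 2))).pow (n + 1 - i)
    rw [hR]
    refine MvPolynomial.IsHomogeneous.C_mul ?_ _
    simpa using (h1.mul h2).mul h3
  have hmono : (monomial (resExp p q) (1 : 𝕜)) = X 0 ^ q * X 1 ^ p := by
    rw [X_pow_eq, X_pow_eq, monomial_mul_monomial, one_mul, resExp]
  -- multiply by `x y` to express the derivatives of the monomial
  have hmul : X 0 * (X 1 * alongField (I * (pertX 𝕜 p n i : MvPowerSeries (Fin 2) 𝕜))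
      (I * (pertY 𝕜 q n i : MvPowerSeries (Fin 2) 𝕜)) (monomial (resExp p q) 1)) =
      I * (R : MvPowerSeries (Fin 2) 𝕜) := by
    have h0 := X_mul_pderiv_monomial (𝕜 := 𝕜) 0 (resExp p q)
    have h1 := X_mul_pderiv_monomial (𝕜 := 𝕜) 1 (resExp p q)
    rw [resExp_zero] at h0
    rw [resExp_one] at h1
    have h2 := congrArg (fun F : MvPolynomial (Fin 2) 𝕜 => (F : MvPowerSeries (Fin 2) 𝕜))
      (pert_combination (𝕜 := 𝕜) (p := p) (q := q) hi)
    simp only [MvPolynomial.coe_add, MvPolynomial.coe_mul, MvPolynomial.coe_C,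
      MvPolynomial.coe_X, MvPolynomial.coe_pow] at h2
    calc _ = I * (X 1 * (pertX 𝕜 p n i : MvPowerSeries (Fin 2) 𝕜) *
            (X 0 * pderiv 𝕜 0 (monomial (resExp p q) 1)) +
          X 0 * (pertY 𝕜 q n i : MvPowerSeries (Fin 2) 𝕜) *
            (X 1 * pderiv 𝕜 1 (monomial (resExp p q) 1))) := by
          simp only [alongField]; ring
      _ = I * ((C (q : 𝕜) * X 1 * (pertX 𝕜 p n i : MvPowerSeries (Fin 2) 𝕜) +
          C (p : 𝕜) * X 0 * (pertY 𝕜 q n i : MvPowerSeries (Fin 2) 𝕜)) *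
            monomial (resExp p q) 1) := by rw [h0, h1]; ring
      _ = _ := by
          rw [h2, hmono, hR]
          simp only [MvPolynomial.coe_add, MvPolynomial.coe_mul, MvPolynomial.coe_C,
            MvPolynomial.coe_X, MvPolynomial.coe_pow]
          ring
  have hcoeff := congrArg (coeff (Finsupp.single 0 1 + (Finsupp.single 1 1 + M))) hmul
  rw [X, X, coeff_add_monomial_mul, coeff_add_monomial_mul, one_mul, one_mul] at hcoeff
  have hpq : n = (p + q) * m := by rw [hn, hSdef, hTdef]; ring
  have hDj : D * j * (p + q) = D * (s + 1) := by rw [← hs]; ring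
  have hdeg : (Finsupp.single 0 1 + (Finsupp.single 1 1 + M) : Fin 2 →₀ ℕ).degree =
      i + q + p + (n + 1 - i) + D * s := by
    rw [map_add, map_add, Finsupp.degree_single, Finsupp.degree_single, hM, degree_smul_resExp,
      add_mul, hDj, mul_add]
    omega
  rw [hcoeff, coeff_geomInverse_mul hD0 hRhom hdeg]
  have hprod : baseForm 𝕜 S T ^ s * R = MvPolynomial.C ((p : 𝕜) * q) *
      (MvPolynomial.X 0 ^ ((S - 1) * s + (i + q)) * MvPolynomial.X 1 ^ p *
        (MvPolynomial.X 0 + MvPolynomial.X 1) ^ (T * s + (n + 1 - i))) := by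
    rw [hR, baseForm, mul_pow, ← pow_mul, ← pow_mul, pow_add _ _ (i + q), pow_add _ (T * s)]
    ring
  have hM1 : (Finsupp.single 0 1 + (Finsupp.single 1 1 + M) : Fin 2 →₀ ℕ) 1 =
      p + (D * (p * j) + 1) := by
    simp [hM, resExp_one]; ring
  rw [hprod, MvPolynomial.coeff_C_mul, coeff_X_pow_mul_X_pow_mul_add_pow, hM1,
    Nat.add_sub_cancel_left, ← mul_assoc, hs, Nat.add_sub_cancel]
  · congr 3
    have : n * (p * j) = T * (s + 1) := by rw [← hs, hpq, hTdef]; ring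
    rw [this, mul_add, mul_one, Nat.add_sub_cancel, add_comm]
  · rw [hdeg]
    have : D * s = (S - 1) * s + T * s := by rw [← add_mul]; congr 1; omega
    omega
  · rw [hM1]; omega

end Family

/-! ### Saddle order and degree of the polynomial systems -/

section Family

variable {𝕜 : Type*} [Field 𝕜]

lemma alongField_sum_smul {ι : Type*} [Fintype ι] (c : ι → 𝕜)
    (A B : ι → MvPowerSeries (Fin 2) 𝕜) (H : MvPowerSeries (Fin 2) 𝕜) :
    alongField (∑ i, c i • A i) (∑ i, c i • B i) H = ∑ i, c i • alongField (A i) (B i) H := by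
  simp only [alongField, sum_mul, smul_add, sum_add_distrib, smul_mul_assoc]

lemma normalIntegral_zero (p q : ℕ) :
    normalIntegral p q (0 : MvPowerSeries (Fin 2) 𝕜) 0 = monomial (resExp p q) 1 := by
  have h0 : ∀ H : MvPowerSeries (Fin 2) 𝕜, alongField 0 0 H = 0 := fun H => by
    simp [alongField]
  have hV : VanishesBelow 2 (0 : MvPowerSeries (Fin 2) 𝕜) := fun m _ => by simp
  rw [normalIntegral, h0, ← correctionStep_correction hV hV, correctionStep, h0, add_zero]
  ext m
  rw [map_add, coeff_solveLinear]
  simp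

/-- Multiplication of a system by a unit with constant term one does not change the leading term of
the derivative of a formal series. -/
lemma isNonlinear_and_hasSaddleOrder_of_unit_mul [CharZero 𝕜] {p q : ℕ} (hp : 0 < p) (hpq : Nat.Coprime p q)
    {P Q : MvPolynomial (Fin 2) 𝕜} {U A B H : MvPowerSeries (Fin 2) 𝕜} {κ : ℕ} (hκ : 1 ≤ κ)
    (hA : VanishesBelow 2 A) (hB : VanishesBelow 2 B) (hU : constantCoeff U = 1)
    (hP : (P : MvPowerSeries (Fin 2) 𝕜) =
      U * ((p : MvPowerSeries (Fin 2) 𝕜) * X 0 + A) - (p : MvPowerSeries (Fin 2) 𝕜) * X 0)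
    (hQ : (Q : MvPowerSeries (Fin 2) 𝕜) =
      U * (-((q : MvPowerSeries (Fin 2) 𝕜) * X 1) + B) + (q : MvPowerSeries (Fin 2) 𝕜) * X 1)
    (hH : VanishesBelow (p + q + 1) (H - monomial (resExp p q) 1))
    (hlow : ∀ m : Fin 2 →₀ ℕ, m.degree ≤ (κ + 1) * (p + q) → m ≠ (κ + 1) • resExp p q →
      coeff m (alongLinear p q H + alongField A B H) = 0)
    (hlead : coeff ((κ + 1) • resExp p q) (alongLinear p q H + alongField A B H) ≠ 0) :
    IsNonlinear P ∧ IsNonlinear Q ∧ HasSaddleOrder p q P Q κ := by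
  set G := alongLinear p q H + alongField A B H with hG
  have hU1 : VanishesBelow 1 (U - 1) := .one_of_constantCoeff (by simp [hU])
  have hX : ∀ i : Fin 2, VanishesBelow 1 (X i : MvPowerSeries (Fin 2) 𝕜) := fun i =>
    .one_of_constantCoeff (by simp)
  have hPV : VanishesBelow 2 (P : MvPowerSeries (Fin 2) 𝕜) := by
    have := (hU1.mul ((hX 0).mul_left (p : MvPowerSeries (Fin 2) 𝕜))).add (hA.mul_left U)
    convert this using 1
    rw [hP]; ring
  have hQV : VanishesBelow 2 (Q : MvPowerSeries (Fin 2) 𝕜) := by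
    have := (hU1.mul ((hX 1).mul_left (-(q : MvPowerSeries (Fin 2) 𝕜)))).add (hB.mul_left U)
    convert this using 1
    rw [hQ]; ring
  have hD : lieDeriv p q P Q H = G + (U - 1) * G := by
    rw [hG, lieDeriv, hP, hQ]
    simp only [alongLinear, alongField]
    ring
  have hGV : VanishesBelow ((κ + 1) * (p + q)) G := fun m hm => by
    refine hlow m hm.le ?_
    rintro rfl
    rw [degree_smul_resExp] at hm
    exact lt_irrefl _ hm
  have hcoeff : ∀ m : Fin 2 →₀ ℕ, m.degree ≤ (κ + 1) * (p + q) →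
      coeff m (lieDeriv p q P Q H) = coeff m G := fun m hm => by
    rw [hD, map_add, (hU1.mul hGV) m (by omega), add_zero]
  have hPN : IsNonlinear P := fun m hm => by
    rw [← MvPolynomial.coeff_coe]; exact hPV m (by omega)
  have hQN : IsNonlinear Q := fun m hm => by
    rw [← MvPolynomial.coeff_coe]; exact hQV m (by omega)
  refine ⟨hPN, hQN, hasSaddleOrder_of_leading hp hpq hPN hQN hκ hH (fun m hm hne => ?_) ?_⟩
  · rw [hcoeff m hm]; exact hlow m hm hne
  · rw [hcoeff _ (degree_smul_resExp ..).le]; exact hlead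

/-- The nonlinear part of the first component of the system obtained from
`(1 + g) (p x ∂/∂x - q y ∂/∂y) + ∑ c i V i` by multiplication with `(1 + x) ^ r`. -/
def familyX (p S T r : ℕ) (c : Fin (S + T + 2) → 𝕜) : MvPolynomial (Fin 2) 𝕜 :=
  (1 + MvPolynomial.X 0) ^ r * (MvPolynomial.C (p : 𝕜) * MvPolynomial.X 0 +
    (MvPolynomial.C (p : 𝕜) * MvPolynomial.X 0 * baseForm 𝕜 S T +
      ∑ i, MvPolynomial.C (c i) * pertX 𝕜 p (S + T) i)) -
    MvPolynomial.C (p : 𝕜) * MvPolynomial.X 0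

/-- The nonlinear part of the second component of that system. -/
def familyY (q S T r : ℕ) (c : Fin (S + T + 2) → 𝕜) : MvPolynomial (Fin 2) 𝕜 :=
  (1 + MvPolynomial.X 0) ^ r * (MvPolynomial.C (-q : 𝕜) * MvPolynomial.X 1 +
    (MvPolynomial.C (-q : 𝕜) * MvPolynomial.X 1 * baseForm 𝕜 S T +
      ∑ i, MvPolynomial.C (c i) * pertY 𝕜 q (S + T) i)) -
    MvPolynomial.C (-q : 𝕜) * MvPolynomial.X 1

lemma totalDegree_unit_mul_sub_le {n r : ℕ} (hn : 1 ≤ n) (i : Fin 2) (a : 𝕜)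
    {F : MvPolynomial (Fin 2) 𝕜} (hF : F.IsHomogeneous n) :
    ((1 + MvPolynomial.X 0) ^ r * (MvPolynomial.C a * MvPolynomial.X i + F) -
      MvPolynomial.C a * MvPolynomial.X i : MvPolynomial (Fin 2) 𝕜).totalDegree ≤ n + r := by
  have hlin : (MvPolynomial.C a * MvPolynomial.X i : MvPolynomial (Fin 2) 𝕜).totalDegree ≤ 1 :=
    ((MvPolynomial.isHomogeneous_X 𝕜 i).C_mul a).totalDegree_le
  have h1 : ((1 + MvPolynomial.X 0) ^ r : MvPolynomial (Fin 2) 𝕜).totalDegree ≤ r := by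
    refine (MvPolynomial.totalDegree_pow _ _).trans ?_
    have : (1 + MvPolynomial.X 0 : MvPolynomial (Fin 2) 𝕜).totalDegree ≤ 1 :=
      (MvPolynomial.totalDegree_add _ _).trans
        (max_le (by simp) (MvPolynomial.isHomogeneous_X 𝕜 0).totalDegree_le)
    nlinarith
  have h2 : (MvPolynomial.C a * MvPolynomial.X i + F).totalDegree ≤ n :=
    (MvPolynomial.totalDegree_add _ _).trans (max_le (hlin.trans hn) hF.totalDegree_le)
  refine (MvPolynomial.totalDegree_sub _ _).trans (max_le ?_ (by omega))
  exact (MvPolynomial.totalDegree_mul _ _).trans (by omega)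

lemma isHomogeneous_linear_mul_baseForm {S T : ℕ} (hS : 0 < S) (a : 𝕜) (i : Fin 2) :
    (MvPolynomial.C a * MvPolynomial.X i * baseForm 𝕜 S T).IsHomogeneous (S + T) := by
  have := ((MvPolynomial.isHomogeneous_X 𝕜 i).C_mul a).mul (isHomogeneous_baseForm (𝕜 := 𝕜)
    (T := T) hS)
  rwa [show 1 + (S + T - 1) = S + T by omega] at this

lemma totalDegree_familyX_le {p S T r : ℕ} (hS : 0 < S) (c : Fin (S + T + 2) → 𝕜) :
    (familyX p S T r c).totalDegree ≤ S + T + r :=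
  totalDegree_unit_mul_sub_le (by omega) 0 _ ((isHomogeneous_linear_mul_baseForm hS _ _).add
    (MvPolynomial.IsHomogeneous.sum _ _ _ fun i _ => (isHomogeneous_pertX _ _ _).C_mul _))

lemma totalDegree_familyY_le {q S T r : ℕ} (hS : 0 < S) (c : Fin (S + T + 2) → 𝕜) :
    (familyY q S T r c).totalDegree ≤ S + T + r :=
  totalDegree_unit_mul_sub_le (by omega) 1 _ ((isHomogeneous_linear_mul_baseForm hS _ _).add
    (MvPolynomial.IsHomogeneous.sum _ _ _ fun i _ => (isHomogeneous_pertY _ _ _).C_mul _))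

/-- The condition on `c` keeps the coefficient of `x ^ (n + r)` nonzero; it is read off on the line
`y = 0`. -/
lemma le_totalDegree_familyX [CharZero 𝕜] {p S T r : ℕ} (hp : 0 < p) (hS : 0 < S) (hT : 0 < T)
    {c : Fin (S + T + 2) → 𝕜}
    (hc : 1 + ∑ i, c i * (if (i : ℕ) ≤ S + T then 1 else 0) ≠ 0) :
    S + T + r ≤ (familyX p S T r c).totalDegree := by
  set b := 1 + ∑ i, c i * (if (i : ℕ) ≤ S + T then 1 else 0) with hb
  have hp' : (p : 𝕜) ≠ 0 := Nat.cast_ne_zero.2 hp.ne'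
  set ψ : MvPolynomial (Fin 2) 𝕜 →ₐ[𝕜] Polynomial 𝕜 :=
    MvPolynomial.aeval fun i => if i = 0 then Polynomial.X else 0 with hψ
  have hX0 : ψ (MvPolynomial.X 0) = Polynomial.X := by simp [hψ]
  have hX1 : ψ (MvPolynomial.X 1) = 0 := by simp [hψ]
  have hC : ∀ a, ψ (MvPolynomial.C a) = Polynomial.C a := fun a => by
    simp [hψ, Polynomial.C_eq_algebraMap]
  have hpert : ∀ i : ℕ, ψ (pertX 𝕜 p (S + T) i) =
      Polynomial.C (p : 𝕜) * (Polynomial.C (if i ≤ S + T then 1 else 0) * Polynomial.X ^ (S + T)) := by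
    intro i
    rw [pertX]
    split_ifs with h
    · simp only [map_mul, map_pow, map_add, hX0, hX1, hC, add_zero, ← pow_add]
      rw [show i + (S + T - i) = S + T by omega, map_one, one_mul]
    · simp
  have hbase : ψ (baseForm 𝕜 S T) = Polynomial.X ^ (S + T - 1) := by
    simp only [baseForm, map_mul, map_pow, map_add, hX0, hX1, add_zero, ← pow_add]
    congr 1; omega
  set B : Polynomial 𝕜 :=
    Polynomial.C (p : 𝕜) * Polynomial.X + Polynomial.C (p * b) * Polynomial.X ^ (S + T) with hB
  have hval : ψ (familyX p S T r c) =
      (1 + Polynomial.X) ^ r * B - Polynomial.C (p : 𝕜) * Polynomial.X := by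
    have hpow : (Polynomial.X : Polynomial 𝕜) ^ (S + T) = Polynomial.X * Polynomial.X ^ (S + T - 1) := by
      rw [← pow_succ']; congr 1; omega
    simp only [familyX, map_sub, map_mul, map_pow, map_add, map_one, hX0, hC, map_sum,
      hpert, hbase, hB, hb]
    congr 3
    rw [mul_assoc _ Polynomial.X (Polynomial.X ^ (S + T - 1)), ← hpow, mul_add, mul_one, add_mul,
      mul_sum, sum_mul]
    congr 1
    refine sum_congr rfl fun i _ => ?_
    ring
  have hBdeg : B.natDegree = S + T := by
    rw [hB, Polynomial.natDegree_add_eq_right_of_natDegree_lt,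
      Polynomial.natDegree_C_mul_X_pow _ _ (mul_ne_zero hp' hc)]
    rw [Polynomial.natDegree_C_mul_X_pow _ _ (mul_ne_zero hp' hc),
      Polynomial.natDegree_C_mul_X _ hp']
    omega
  have hone : (1 + Polynomial.X : Polynomial 𝕜).natDegree = 1 := by
    rw [add_comm, ← Polynomial.C_1]; exact Polynomial.natDegree_X_add_C _
  have hdeg : (ψ (familyX p S T r c)).natDegree = S + T + r := by
    have hmul : ((1 + Polynomial.X) ^ r * B).natDegree = S + T + r := by
      rw [Polynomial.natDegree_mul, Polynomial.natDegree_pow, hone, hBdeg]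
      · ring
      · refine pow_ne_zero _ fun h => ?_
        rw [h] at hone; simp at hone
      · intro h
        rw [h] at hBdeg
        simp at hBdeg; omega
    rw [hval, Polynomial.natDegree_sub_eq_left_of_natDegree_lt, hmul]
    rw [hmul, Polynomial.natDegree_C_mul_X _ hp']
    omega
  have := MvPolynomial.aeval_natDegree_le (m := (familyX p S T r c).totalDegree) (n := 1)
    (familyX p S T r c) le_rfl (fun i => if i = 0 then (Polynomial.X : Polynomial 𝕜) else 0)
    (fun i => by split_ifs <;> simp)
  rw [mul_one] at this
  exact hdeg ▸ this

end Family

/-! ### Existence of systems of high saddle order -/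

section Existence

variable {𝕜 : Type*} [RCLike 𝕜]

/-- For `n = m (p + q)`, `m ≥ 2`, some member of the family has saddle order exactly `n ^ 2 - 1`,
and its degree can be raised by `r`. -/
lemma exists_hasSaddleOrder {p q m : ℕ} (hp : 0 < p) (hq : 0 < q) (hpq : Nat.Coprime p q)
    (hm : 2 ≤ m) (r : ℕ) :
    ∃ P Q : MvPolynomial (Fin 2) 𝕜, IsNonlinear P ∧ IsNonlinear Q ∧
      max P.totalDegree Q.totalDegree = q * m + p * m + r ∧
      HasSaddleOrder p q P Q ((q * m + p * m - 1) * (q * m + p * m + 1)) := by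
  classical
  have hS : 2 ≤ q * m := by nlinarith
  have hT : 2 ≤ p * m := by nlinarith
  have hnpq : q * m + p * m = (p + q) * m := by ring
  have hmat := fun (d : ℕ → 𝕜) => eq_zero_of_sum_mul_choose_eq_zero (𝕜 := 𝕜) (S := q * m)
    (T := p * m) (p := p) (by omega) (by omega) hp (d := d)
  have hmoment := fun (j : ℕ) (hj : 0 < j) (i : ℕ) => coeff_alongField_pert (𝕜 := 𝕜) (p := p)
    (q := q) (m := m) (j := j) hp hq (by omega) hj (i := i)
  have hdegX := fun c => totalDegree_familyX_le (𝕜 := 𝕜) (p := p) (S := q * m) (T := p * m)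
    (r := r) (by omega) c
  have hdegY := fun c => totalDegree_familyY_le (𝕜 := 𝕜) (q := q) (S := q * m) (T := p * m)
    (r := r) (by omega) c
  have hdeg := fun c => le_totalDegree_familyX (𝕜 := 𝕜) (p := p) (S := q * m) (T := p * m)
    (r := r) hp (by omega) (by omega) (c := c)
  have hgh := isHomogeneous_baseForm (𝕜 := 𝕜) (S := q * m) (T := p * m) (by omega)
  set S := q * m with hSdef
  set T := p * m with hTdef
  set n := S + T with hn
  set D := n - 1 with hD
  have hD0 : 0 < D := by omega
  set g := baseForm 𝕜 S T with hg
  set I := geomInverse D g with hI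
  have hgI : (1 + (g : MvPowerSeries (Fin 2) 𝕜)) * I = 1 := one_add_mul_geomInverse hD0 hgh
  have hcop : Nat.Coprime D (p + q) := by
    have h1 : D + 1 = (p + q) * m := by omega
    have h2 : Nat.Coprime D (D + 1) := by simp
    rw [h1] at h2
    exact h2.coprime_mul_right_right
  -- the components of the perturbations after division by `1 + g`
  set a : Fin (n + 2) → MvPowerSeries (Fin 2) 𝕜 := fun i =>
    I * (pertX 𝕜 p n i : MvPowerSeries (Fin 2) 𝕜) with ha
  set b : Fin (n + 2) → MvPowerSeries (Fin 2) 𝕜 := fun i =>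
    I * (pertY 𝕜 q n i : MvPowerSeries (Fin 2) 𝕜) with hb
  have hhomV : ∀ F : MvPolynomial (Fin 2) 𝕜, F.IsHomogeneous n →
      VanishesBelow 2 (I * (F : MvPowerSeries (Fin 2) 𝕜)) := fun F hF =>
    VanishesBelow.mul_left _ fun e he => by
      rw [MvPolynomial.coeff_coe]
      exact hF.coeff_eq_zero (by omega)
  have hhomM : ∀ F : MvPolynomial (Fin 2) 𝕜, F.IsHomogeneous n →
      SupportedMod D 1 (I * (F : MvPowerSeries (Fin 2) 𝕜)) := fun F hF => by
    refine supportedMod_geomInverse.mul (b := 1) fun e he => ?_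
    rw [MvPolynomial.coeff_coe]
    refine hF.coeff_eq_zero fun h => he ?_
    rw [h, show n = D + 1 by omega]
    simp [Nat.ModEq]
  set A : (Fin (n + 2) → 𝕜) → MvPowerSeries (Fin 2) 𝕜 := fun c => ∑ i, c i • a i with hA
  set B : (Fin (n + 2) → 𝕜) → MvPowerSeries (Fin 2) 𝕜 := fun c => ∑ i, c i • b i with hB
  have hAV : ∀ c, VanishesBelow 2 (A c) := fun c =>
    .sum _ fun i _ => (hhomV _ (isHomogeneous_pertX _ _ _)).smul _
  have hBV : ∀ c, VanishesBelow 2 (B c) := fun c =>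
    .sum _ fun i _ => (hhomV _ (isHomogeneous_pertY _ _ _)).smul _
  have hAM : ∀ c, SupportedMod D 1 (A c) := fun c =>
    .sum _ fun i _ => (hhomM _ (isHomogeneous_pertX _ _ _)).smul _
  have hBM : ∀ c, SupportedMod D 1 (B c) := fun c =>
    .sum _ fun i _ => (hhomM _ (isHomogeneous_pertY _ _ _)).smul _
  set H : (Fin (n + 2) → 𝕜) → MvPowerSeries (Fin 2) 𝕜 := fun c =>
    normalIntegral p q (A c) (B c) with hH
  -- row `0` records the coordinate `c (S + 2)`, row `j` the saddle value number `D * j`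
  set φ : Fin (n + 2) → Fin (n + 2) → (Fin (n + 2) → 𝕜) → 𝕜 := fun i j c =>
    if (j : ℕ) = 0 then (if (i : ℕ) = S + 2 then 1 else 0) else
      coeff ((D * j + 1) • resExp p q) (alongField (a i) (b i) (H c)) with hφ
  have hsmooth : ∀ i j, ContDiff 𝕜 1 (φ i j) := by
    intro i j
    by_cases hj : (j : ℕ) = 0
    · simp only [hφ, hj, if_true]
      exact contDiff_const
    · simp only [hφ, hj, if_false]
      have hAc : ContDiffCoeffs A := .sum _ fun i _ => .smul (contDiff_apply 𝕜 𝕜 i) (.const _)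
      have hBc : ContDiffCoeffs B := .sum _ fun i _ => .smul (contDiff_apply 𝕜 𝕜 i) (.const _)
      have hHc : ContDiffCoeffs H :=
        (ContDiffCoeffs.const _).add (hAc.correction hBc (hAc.alongField hBc (.const _)))
      exact (ContDiffCoeffs.const (a i)).alongField (.const (b i)) hHc _
  have hH0 : H 0 = monomial (resExp p q) 1 := by
    simp only [hH, hA, hB, Pi.zero_apply, zero_smul, sum_const_zero]
    exact normalIntegral_zero p q
  have hinj : ∀ v : Fin (n + 2) → 𝕜, (∀ j, ∑ i, v i * φ i j 0 = 0) → v = 0 := by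
    intro v hv
    set d : ℕ → 𝕜 := fun i => if h : i < n + 2 then v ⟨i, h⟩ else 0 with hd
    have hdv : ∀ i : Fin (n + 2), v i = d i := fun i => by simp [hd]
    have hd2 : d (S + 2) = 0 := by
      have h0 := hv 0
      rw [Finset.sum_eq_single (⟨S + 2, by omega⟩ : Fin (n + 2))] at h0
      · simpa [hφ, hdv] using h0
      · intro i _ hi
        have : (i : ℕ) ≠ S + 2 := fun h => hi (Fin.ext h)
        simp [hφ, this]
      · simp
    have hzero : ∀ i < n + 2, d i = 0 := fun i hi => by
      refine hmat d hd2 (fun j hj => ?_) hi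
      rw [mem_Icc] at hj
      have h1 := hv ⟨j, by omega⟩
      have hconst : ((-1) ^ ((p + q) * j - 1) * ((p : 𝕜) * q)) ≠ 0 :=
        mul_ne_zero (pow_ne_zero _ (by norm_num))
          (mul_ne_zero (Nat.cast_ne_zero.2 hp.ne') (Nat.cast_ne_zero.2 hq.ne'))
      refine (mul_eq_zero.1 ?_).resolve_left hconst
      rw [← h1, ← Fin.sum_univ_eq_sum_range (fun i => d i * ((n + 1 - i + (n * (p * j) - T)).choose
        (D * (p * j) + 1) : 𝕜)), mul_sum]
      refine sum_congr rfl fun i _ => ?_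
      have hj0 : j ≠ 0 := by omega
      simp only [hφ, hj0, if_false, hH0, ha, hb]
      rw [hmoment j (by omega) i (by omega), hdv]
      ring
    ext i
    rw [hdv, hzero i i.2, Pi.zero_apply]
  -- choose `c` near `0` with all saddle values zero up to the one of number `D * (n + 1)`
  obtain ⟨ε, hε, c, hc, hcε⟩ : ∃ ε : 𝕜, ε ≠ 0 ∧ ∃ c : Fin (n + 2) → 𝕜,
      1 + ∑ i, c i * (if (i : ℕ) ≤ n then 1 else 0) ≠ 0 ∧
      (fun j => ∑ i, c i * φ i j c) = Pi.single (Fin.last (n + 1)) ε := by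
    have hmap := map_nhds_zero_sum_mul hsmooth hinj
    have hU : {c : Fin (n + 2) → 𝕜 | 1 + ∑ i, c i * (if (i : ℕ) ≤ n then 1 else 0) ≠ 0} ∈
        nhds (0 : Fin (n + 2) → 𝕜) := by
      refine IsOpen.mem_nhds ?_ (by simp)
      exact isOpen_ne_fun (by fun_prop) continuous_const
    have himg := Filter.image_mem_map (m := fun (c : Fin (n + 2) → 𝕜) j => ∑ i, c i * φ i j c) hU
    rw [hmap] at himg
    have hcont : Filter.Tendsto (fun ε : 𝕜 => (Pi.single (Fin.last (n + 1)) ε :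
        Fin (n + 2) → 𝕜)) (nhds 0) (nhds 0) := by
      have := (continuous_single (A := fun _ : Fin (n + 2) => 𝕜) (Fin.last (n + 1))).tendsto 0
      rwa [Pi.single_zero] at this
    have hev := (hcont.mono_left (nhdsWithin_le_nhds (s := {0}ᶜ))).eventually himg
    obtain ⟨ε, ⟨c, hc, hcε⟩, hε⟩ := (hev.and self_mem_nhdsWithin).exists
    exact ⟨ε, hε, c, hc, hcε⟩
  have hLval : ∀ j : ℕ, 1 ≤ j → j ≤ n + 1 →
      coeff ((D * j + 1) • resExp p q) (alongField (A c) (B c) (H c)) =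
        if j = n + 1 then ε else 0 := by
    intro j hj1 hj2
    have h1 := congrFun hcε ⟨j, by omega⟩
    have hj0 : j ≠ 0 := by omega
    simp only [hφ, hj0, if_false] at h1
    rw [hA, hB, alongField_sum_smul, map_sum]
    simp only [coeff_smul]
    rw [h1]
    by_cases h : j = n + 1
    · subst h
      simp [Pi.single_apply, Fin.ext_iff]
    · simp [h, Fin.ext_iff]
  set κ := D * (n + 1) with hκ
  have hκ1 : 1 ≤ κ := Nat.mul_pos hD0 (by omega)
  have hcA : ∀ (c : Fin (n + 2) → 𝕜) (F : Fin (n + 2) → MvPolynomial (Fin 2) 𝕜),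
      (1 + (g : MvPowerSeries (Fin 2) 𝕜)) * ∑ i, c i • (I * (F i : MvPowerSeries (Fin 2) 𝕜)) =
        ((∑ i, MvPolynomial.C (c i) * F i : MvPolynomial (Fin 2) 𝕜) :
          MvPowerSeries (Fin 2) 𝕜) := by
    intro c F
    have hsum : ((∑ i, MvPolynomial.C (c i) * F i : MvPolynomial (Fin 2) 𝕜) :
        MvPowerSeries (Fin 2) 𝕜) =
        ∑ i, ((MvPolynomial.C (c i) * F i : MvPolynomial (Fin 2) 𝕜) : MvPowerSeries (Fin 2) 𝕜) :=
      map_sum MvPolynomial.coeToMvPowerSeries.ringHom _ _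
    rw [hsum, mul_sum]
    refine sum_congr rfl fun i _ => ?_
    rw [MvPolynomial.coe_mul, MvPolynomial.coe_C, smul_eq_C_mul]
    linear_combination (C (c i) * (F i : MvPowerSeries (Fin 2) 𝕜)) * hgI
  have hgc : constantCoeff (g : MvPowerSeries (Fin 2) 𝕜) = 0 := by
    rw [← coeff_zero_eq_constantCoeff_apply, MvPolynomial.coeff_coe]
    exact hgh.coeff_eq_zero (by simp; omega)
  have horder : IsNonlinear (familyX p S T r c) ∧ IsNonlinear (familyY q S T r c) ∧
      HasSaddleOrder p q (familyX p S T r c) (familyY q S T r c) κ := by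
    refine isNonlinear_and_hasSaddleOrder_of_unit_mul hp hpq
      (U := (1 + X 0) ^ r * (1 + (g : MvPowerSeries (Fin 2) 𝕜))) (A := A c) (B := B c)
      (H := H c) hκ1 (hAV c) (hBV c) (by simp [hgc]) ?_ ?_
      (vanishesBelow_normalIntegral_sub (hAV c) (hBV c)) (fun e he hne => ?_) ?_
    · rw [mul_assoc ((1 + X 0) ^ r), mul_add (1 + (g : MvPowerSeries (Fin 2) 𝕜)), hA, hcA c,
        familyX, ← MvPolynomial.coeToMvPowerSeries.ringHom_apply]
      simp only [map_sub, map_mul, map_add, map_pow, map_one]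
      simp only [MvPolynomial.coeToMvPowerSeries.ringHom_apply, MvPolynomial.coe_X,
        map_natCast, ← hg]
      ring
    · rw [mul_assoc ((1 + X 0) ^ r), mul_add (1 + (g : MvPowerSeries (Fin 2) 𝕜)), hB, hcA c,
        familyY, ← MvPolynomial.coeToMvPowerSeries.ringHom_apply]
      simp only [map_sub, map_mul, map_add, map_pow, map_one]
      simp only [MvPolynomial.coeToMvPowerSeries.ringHom_apply, MvPolynomial.coe_X,
        map_neg, map_natCast, ← hg]
      ring
    · by_cases hres : (p : 𝕜) * e 0 - q * e 1 = 0
      · obtain ⟨k, rfl⟩ := exists_eq_smul_resExp hp hpq hres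
        rw [map_add, coeff_smul_resExp_alongLinear, zero_add]
        rw [degree_smul_resExp] at he
        have hk : k ≤ κ + 1 := Nat.le_of_mul_le_mul_right he (by omega)
        have hkne : k ≠ κ + 1 := fun h => hne (by rw [h])
        rcases Nat.lt_or_ge k 2 with hk2 | hk2
        · refine vanishesBelow_alongField_normalIntegral (hAV c) (hBV c) _ ?_
          rw [degree_smul_resExp]
          nlinarith
        · obtain ⟨k, rfl⟩ : ∃ k', k = k' + 1 := ⟨k - 1, by omega⟩
          by_cases hdvd : D ∣ k
          · obtain ⟨j, rfl⟩ := hdvd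
            have hj : j < n + 1 := by
              by_contra hj
              have := Nat.mul_le_mul_left D (not_lt.1 hj)
              omega
            have hj1 : 1 ≤ j := by
              by_contra h0
              obtain rfl : j = 0 := by omega
              omega
            rw [hLval j hj1 hj.le, if_neg hj.ne]
          · refine supportedMod_alongField_normalIntegral hp (hAM c) (hBM c) _ fun h => hdvd ?_
            rw [degree_smul_resExp, add_mul, one_mul] at h
            have h' : k * (p + q) ≡ 0 [MOD D] := Nat.ModEq.add_right_cancel' (p + q) (by simpa using h)
            exact hcop.dvd_of_dvd_mul_right ((Nat.modEq_zero_iff_dvd).1 h')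
      · exact coeff_normalIntegral_of_nonresonant (hAV c) (hBV c) hres
    · rw [map_add, coeff_smul_resExp_alongLinear, zero_add, hκ, hLval (n + 1) (by omega) le_rfl,
        if_pos rfl]
      exact hε
  exact ⟨familyX p S T r c, familyY q S T r c, horder.1, horder.2.1,
    le_antisymm (max_le (hdegX c) (hdegY c)) ((hdeg c hc).trans (le_max_left _ _)), horder.2.2⟩

end Existence

end ResonantSaddle

end

/-- The right-hand side is the integer `n ^ 2 - 2 r n + r ^ 2 - 1`; since `M(p, q, n) ≥ 0`, replacing
a negative integer by `0` does not change the inequality. -/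
theorem theorem2 (𝕜 : Type*) [RCLike 𝕜] (p q : ℕ) (hp : 0 < p) (hq : 0 < q)
    (hpq : Nat.Coprime p q) :
    ∃ N : ℕ, ∀ n : ℕ, N ≤ n → ∀ r : ℕ, r ≤ p + q - 1 → r ≡ n [MOD p + q] →
      ResonantSaddle.maxSaddleOrder 𝕜 p q n ≥
        ((((n : ℤ) ^ 2 - 2 * (r : ℤ) * (n : ℤ) + (r : ℤ) ^ 2 - 1).toNat : ℕ) : ℕ∞) := by
  refine ⟨3 * (p + q), fun n hn r hr hrn => ?_⟩
  obtain ⟨m, hm⟩ := (Nat.modEq_iff_dvd' (by omega : r ≤ n)).1 hrn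
  have hm2 : 2 ≤ m := by
    by_contra h
    have : (p + q) * m ≤ (p + q) * 1 := Nat.mul_le_mul_left _ (by omega)
    omega
  obtain ⟨P, Q, hP, hQ, hdeg, hord⟩ :=
    ResonantSaddle.exists_hasSaddleOrder (𝕜 := 𝕜) hp hq hpq hm2 r
  have hd : q * m + p * m = n - r := by rw [hm]; ring
  rw [hd] at hdeg hord
  refine le_sSup ⟨P, Q, _, hP, hQ, by rw [hdeg]; omega, hord, ?_⟩
  congr 1
  have h1 : 1 ≤ n - r := by omega
  have h2 : r ≤ n := by omega
  zify [h1, h2]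
  rw [Int.toNat_of_nonneg]
  · ring
  · have : (1 : ℤ) ≤ (n - r : ℤ) := by omega
    nlinarith
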